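/- Let $n\ge 1$ and $s=2n+1$. For real $a,b>0$ let $L=L(2n+1,2,2)$ be the lemniscate knot obtained by closing the braid whose $s$ strands are $$\Bigl(a\cos\tfrac{2h+2\pi (j-1)}{s},\ \tfrac b2\sin\tfrac{2(2h+2\pi (j-1))}{s},\ h\Bigr),\qquad 0\le h\le 2\pi,\quad j=1,\dots,s.$$ Braid words are read off from the projection along the second coordinate, following $h$ downwards and numbering positions by increasing first coordinate; the strand with the larger second coordinate passes over, and $\sigma_i$ denotes a crossing of the strands in positions $i,i+1$ in which the strand passing over comes from the left. Two braid words (on any numbers of strands) are regarded as having the same closure if they are related by a finite sequence of the relations of Artin's braid group and Markov moves (conjugation; insertion or removal of a first or last generator $\sigma^{\pm1}$ that occurs exactly once); by Markov's theorem this means that the closed braids are isotopic. Then: 1. all braid words read off from these strands, for all $a,b>0$, have the same closure $L$; 2. the three-strand word $\sigma_1^{-1}\sigma_2^{n}\sigma_1^{-n}\sigma_2$ is a minimal braid word of $L$: its closure is $L$, and among all braid words (on any number of strands) with closure $L$ it has both the smallest number of letters, $2n+2$, and the smallest number of strands; 3. up to multiplication by a unit $\pm t^m$, the Alexander polynomial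 of $L$ is $$\Delta_L(t)=\sum_{k=-n}^{n}(-1)^{n+k}\bigl(2(n-|k|)+1\bigr)t^k;$$ 4. up to a unit $\pm t^m$, $\Delta_L(t)$ equals each $2\times 2$ minor of $B-I$, where $B$ is the $3\times3$ unreduced Burau matrix of the word $\sigma_1^{-1}\sigma_2^{n}\sigma_1^{-n}\sigma_2$. -/

import Mathlib

namespace LemniscateKnot

open Filter Topology LaurentPolynomial

/-! ### Braid words and the Artin braid groups -/

/-- A braid word on `k + 1` strands: the letter `(i, true)` is the generator `σ_{i+1}`, and
`(i, false)` is its inverse.  Words are read from left to right, following the braid downwards;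
`σ_{i+1}` crosses the strands in positions `i + 1` and `i + 2` from the left, and it is positive
when the overcrossing strand comes from the left. -/
abbrev BraidWord (k : ℕ) : Type := List (Fin k × Bool)

/-- The Artin relators of the braid group on `k + 1` strands. -/
def braidRels (k : ℕ) : Set (FreeGroup (Fin k)) :=
  {g | ∃ i j : Fin k, (i : ℕ) + 1 < j ∧
      g = FreeGroup.of i * FreeGroup.of j * (FreeGroup.of j * FreeGroup.of i)⁻¹} ∪
  {g | ∃ i j : Fin k, (i : ℕ) + 1 = j ∧
      g = FreeGroup.of i * FreeGroup.of j * FreeGroup.of i *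
        (FreeGroup.of j * FreeGroup.of i * FreeGroup.of j)⁻¹}

/-- The Artin braid group on `k + 1` strands. -/
abbrev BraidGroup (k : ℕ) : Type := PresentedGroup (braidRels k)

/-- The braid represented by a word. -/
def BraidWord.toBraid {k : ℕ} (w : BraidWord k) : BraidGroup k :=
  PresentedGroup.mk (braidRels k) (FreeGroup.mk w)

/-- Add an unused strand on the right: `σ_i ↦ σ_i`. -/
def BraidWord.addRight {k : ℕ} (w : BraidWord k) : BraidWord (k + 1) :=
  w.map fun x => (x.1.castSucc, x.2)

/-- Add an unused strand on the left: `σ_i ↦ σ_{i+1}`. -/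
def BraidWord.addLeft {k : ℕ} (w : BraidWord k) : BraidWord (k + 1) :=
  w.map fun x => (x.1.succ, x.2)

/-! ### Link types of closed braids -/

/-- The elementary moves on braid words (on varying numbers of strands) that preserve the isotopy
class of the closure: the relations of the braid group, and the Markov moves, namely conjugation
and the removal of a last (or first) generator that occurs exactly once. -/
inductive MarkovMove : (Σ k : ℕ, BraidWord k) → (Σ k : ℕ, BraidWord k) → Prop
  | braid {k : ℕ} (w w' : BraidWord k) (h : w.toBraid = w'.toBraid) : MarkovMove ⟨k, w⟩ ⟨k, w'⟩
  | conj {k : ℕ} (u v : BraidWord k) : MarkovMove ⟨k, u ++ v⟩ ⟨k, v ++ u⟩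
  | destabLast {k : ℕ} (u v : BraidWord k) (e : Bool) :
      MarkovMove ⟨k + 1, u.addRight ++ [(Fin.last k, e)] ++ v.addRight⟩ ⟨k, u ++ v⟩
  | destabFirst {k : ℕ} (u v : BraidWord k) (e : Bool) :
      MarkovMove ⟨k + 1, u.addLeft ++ [((0 : Fin (k + 1)), e)] ++ v.addLeft⟩ ⟨k, u ++ v⟩

/-- Isotopy classes of (oriented) links, as closed braids: the classes of braid words under the
equivalence relation generated by the braid relations and the Markov moves.  By the theorems of
Alexander and Markov these correspond to the isotopy classes of oriented links in 3-space. -/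
def LinkType : Type := Quot MarkovMove

/-- The link type of the closure of a braid word. -/
def BraidWord.closure {k : ℕ} (w : BraidWord k) : LinkType := Quot.mk MarkovMove ⟨k, w⟩

/-- `w` is a minimal braid word of the link type `L`: its closure is `L`, and among all braid words
(on any number of strands) with closure `L` it has both the fewest letters (crossings) and the
fewest strands. -/
structure IsMinimalBraidWord {k : ℕ} (w : BraidWord k) (L : LinkType) : Prop where
  closure_eq : w.closure = L
  length_le : ∀ (k' : ℕ) (w' : BraidWord k'), w'.closure = L → w.length ≤ w'.length
  strands_le : ∀ (k' : ℕ) (w' : BraidWord k'), w'.closure = L → k + 1 ≤ k' + 1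

/-! ### Reading a braid word from parametrised strands -/

/-- The strands `p` (over) and `q` (under) of the system `(X_j(h), Y_j(h), h)` form, in the
projection along `Y`, a regular crossing at height `h`, represented by the letter `x`.
Only the two strands meet there and they change sides; the strand with the larger `Y` is the upper
one; the position is counted from the left (small `X`); and the crossing is positive when
the upper strand comes from the left as `h` decreases. -/
structure IsCrossing {k : ℕ} (X Y : Fin (k + 1) → ℝ → ℝ) (h : ℝ) (p q : Fin (k + 1))
    (x : Fin k × Bool) : Prop where
  meet : X p h = X q h
  higher : Y q h < Y p h
  only_two : ∀ m, X m h = X p h → m = p ∨ m = q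
  position : (x.1 : ℕ) = Set.ncard {m | X m h < X p h}
  pos : x.2 = true →
    (∀ᶠ y in 𝓝[>] h, X p y < X q y) ∧ (∀ᶠ y in 𝓝[<] h, X q y < X p y)
  neg : x.2 = false →
    (∀ᶠ y in 𝓝[>] h, X q y < X p y) ∧ (∀ᶠ y in 𝓝[<] h, X p y < X q y)

/-- `w` is a braid word read from the diagram of the strands `(X_j(h), Y_j(h), h)`, following the
braid downwards from `h = 2π` (included) to `h = 0` (excluded, as the two ends are glued): the
letters of `w` list all the crossings, each exactly once, with nonincreasing heights; crossings at
the same height may be listed in any order. -/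
def ReadsAs {k : ℕ} (X Y : Fin (k + 1) → ℝ → ℝ) (w : BraidWord k) : Prop :=
  ∃ (h : Fin w.length → ℝ) (o u : Fin w.length → Fin (k + 1)),
    Antitone h ∧
    (∀ m, h m ∈ Set.Ioc 0 (2 * Real.pi)) ∧
    (∀ m, IsCrossing X Y (h m) (o m) (u m) (w.get m)) ∧
    (Function.Injective fun m => (h m, o m)) ∧
    ∀ y ∈ Set.Ioc 0 (2 * Real.pi), ∀ p q, p ≠ q → X p y = X q y →
      ∃ m, h m = y ∧ ((o m = p ∧ u m = q) ∨ (o m = q ∧ u m = p))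

/-- The horizontal coordinate `X_j(h) = a cos((r h + 2π(j-1))/s)` (`j` counted from `0` here). -/
noncomputable def strandX (s r : ℕ) (a : ℝ) (j : Fin s) (h : ℝ) : ℝ :=
  a * Real.cos ((r * h + 2 * Real.pi * (j : ℕ)) / s)

/-- The coordinate `Y_j(h) = (b/ℓ) sin(ℓ (r h + 2π(j-1))/s)` (`j` counted from `0` here). -/
noncomputable def strandY (s r l : ℕ) (b : ℝ) (j : Fin s) (h : ℝ) : ℝ :=
  b / l * Real.sin (l * (r * h + 2 * Real.pi * (j : ℕ)) / s)

/-- `L` is the link type of the lemniscate knot `L(s, r, ℓ)`, with `s = k + 1` strands and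
stretching factors `a`, `b`: the closure of the braid whose strands follow the `(1, ℓ)` Lissajous
figure. -/
def IsLemniscateKnot (k r l : ℕ) (a b : ℝ) (L : LinkType) : Prop :=
  ∃ w : BraidWord k, ReadsAs (strandX (k + 1) r a) (strandY (k + 1) r l b) w ∧ w.closure = L

/-! ### The Alexander polynomial -/

/-- The automorphism of the free group by which a generator `σ_i^{±1}` acts (Artin):
`σ_i` maps `x_i ↦ x_i x_{i+1} x_i⁻¹`, `x_{i+1} ↦ x_i`. -/
def artinGen {k : ℕ} (x : Fin k × Bool) :
    FreeGroup (Fin (k + 1)) →* FreeGroup (Fin (k + 1)) :=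
  FreeGroup.lift fun m =>
    if m = x.1.castSucc then
      (if x.2 then
        FreeGroup.of x.1.castSucc * FreeGroup.of x.1.succ * (FreeGroup.of x.1.castSucc)⁻¹
      else FreeGroup.of x.1.succ)
    else if m = x.1.succ then
      (if x.2 then FreeGroup.of x.1.castSucc
      else (FreeGroup.of x.1.succ)⁻¹ * FreeGroup.of x.1.castSucc * FreeGroup.of x.1.succ)
    else FreeGroup.of m

/-- The Artin action of a braid word on the free group of the punctured disc. -/
def artin {k : ℕ} : BraidWord k → (FreeGroup (Fin (k + 1)) →* FreeGroup (Fin (k + 1)))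
  | [] => MonoidHom.id _
  | x :: w => (artinGen x).comp (artin w)

/-- The Fox derivative `∂/∂x_j` of a word in a free group, with every generator sent to `t`. -/
noncomputable def foxWord {m : ℕ} (j : Fin m) : List (Fin m × Bool) → ℤ[T;T⁻¹]
  | [] => 0
  | (i, true) :: w => (if i = j then 1 else 0) + T 1 * foxWord j w
  | (i, false) :: w => (if i = j then -T (-1) else 0) + T (-1) * foxWord j w

/-- The Fox derivative `∂/∂x_j` of an element of a free group, with every generator sent to
`t`. -/
noncomputable def fox {m : ℕ} (j : Fin m) (g : FreeGroup (Fin m)) : ℤ[T;T⁻¹] :=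
  foxWord j g.toWord

/-- The Alexander matrix (Fox Jacobian) of the presentation
`⟨x_1, …, x_{k+1} | β(x_i) x_i⁻¹⟩` of the link group of the closure of the braid `β`. -/
noncomputable def alexanderMatrix {k : ℕ} (w : BraidWord k) :
    Matrix (Fin (k + 1)) (Fin (k + 1)) ℤ[T;T⁻¹] :=
  Matrix.of fun i j => fox j (artin w (FreeGroup.of i) * (FreeGroup.of i)⁻¹)

/-- `D` is (a representative, unique up to the units `±t^m`, of) the Alexander polynomial of the
link type `L`: for each braid word with closure `L`, it is a greatest common divisor of the
submaximal minors of the Alexander matrix of the link group. -/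
def IsAlexanderPolynomial (L : LinkType) (D : ℤ[T;T⁻¹]) : Prop :=
  ∀ (k : ℕ) (w : BraidWord k), w.closure = L → ∀ p : ℤ[T;T⁻¹],
    p ∣ D ↔ ∀ i j : Fin (k + 1),
      p ∣ ((alexanderMatrix w).submatrix i.succAbove j.succAbove).det

/-! ### The Burau representation -/

/-- The unreduced Burau matrix of a letter: the identity, except for the block
`[1 - t, t; 1, 0]` for `σ_i`, and `[0, 1; t⁻¹, 1 - t⁻¹]` for `σ_i⁻¹`, in the rows and columns
`i`, `i + 1`. -/
noncomputable def burauGen {k : ℕ} (x : Fin k × Bool) :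
    Matrix (Fin (k + 1)) (Fin (k + 1)) ℤ[T;T⁻¹] :=
  Matrix.of fun p q =>
    if p = x.1.castSucc then
      (if q = x.1.castSucc then (if x.2 then 1 - T 1 else 0)
      else if q = x.1.succ then (if x.2 then T 1 else 1) else 0)
    else if p = x.1.succ then
      (if q = x.1.castSucc then (if x.2 then 1 else T (-1))
      else if q = x.1.succ then (if x.2 then 0 else 1 - T (-1)) else 0)
    else if p = q then 1 else 0

/-- The (unreduced) Burau representation, on braid words. -/
noncomputable def burau {k : ℕ} (w : BraidWord k) :
    Matrix (Fin (k + 1)) (Fin (k + 1)) ℤ[T;T⁻¹] :=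
  (w.map burauGen).prod

/-! ### The word and the polynomial of the theorem -/

/-- The braid word `σ₁⁻¹ σ₂ⁿ σ₁⁻ⁿ σ₂` on three strands. -/
def minimalWord (n : ℕ) : BraidWord 2 :=
  [(0, false)] ++ List.replicate n (1, true) ++ List.replicate n (0, false) ++ [(1, true)]

/-- The Laurent polynomial `∑_{k=-n}^{n} (-1)^{n+k} (2(n-|k|)+1) t^k`. -/
noncomputable def alexanderFormula (n : ℕ) : ℤ[T;T⁻¹] :=
  ∑ k ∈ Finset.Icc (-(n : ℤ)) (n : ℤ),
    C ((Int.negOnePow (n + k) : ℤ) * (2 * ((n : ℤ) - |k|) + 1)) * T k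

end LemniscateKnot

namespace LemniscateKnot

open Filter Topology LaurentPolynomial
open scoped Matrix

/-! Geometry. Write s = 2n+1. Two strands have the same first coordinate only when their angles are
opposite, which forces the height to be N·π/2 with N = 1, 2, 3, 4. There the angles are π·c/s with c
of the parity of N; slots c and -c meet, |c| determines the position from the left, and the sign of
sin(2πc/s) decides which strand is over. Hence the first n generators occur negatively, the last n
positively, and each level carries the generators of one parity. These commute, so every reading
represents the same braid (EO)², where E and O are the products of the signed generators of even and
odd index (`closure_eq_of_perm_entries`).

Reduction. EO is conjugate to the product of the signed generators in increasing order, and braid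
relations rewrite the square of a run of consecutive generators so that an extreme generator occurs
once. Repeated destabilisation from the right and from the left ends at the three-strand word
(`closureOf_right_reduction`, `closureOf_left_reduction`).

Invariant. The Burau matrix B of a word fixes the column of ones and the row (1, t, t², …). So the
adjugate of B - 1 is a single Laurent polynomial `reducedDet` times a rank-one matrix, and all
submaximal minors are associated to it. Markov moves change `reducedDet` only by units. The Fox
Jacobian of the Artin action is the Burau matrix of the reversed word, with the same `reducedDet`;
this identifies `reducedDet` with the Alexander polynomial, and a 2 × 2 determinant computes it.

Minimality. Each letter widens the exponent range of the relevant determinants by at most one, and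
t^i · `reducedDet` obeys the same bounds for i = 0, …, k. Hence a word on k+1 strands has at least
2n+k letters (`le_length_of_associated`). One strand admits no letters; on two strands the
determinant of B, a unit, is 1 + (1+t)·`reducedDet`, which contradicts the two top coefficients 1
and -3. So k ≥ 2, and both bounds follow. -/

/-! ### The Burau matrices as rank-one perturbations of the identity -/

/-- The column vector of `burauGen x - 1`. -/
noncomputable def burauCol {k : ℕ} (x : Fin k × Bool) : Fin (k + 1) → ℤ[T;T⁻¹] :=
  Pi.single x.1.castSucc (if x.2 then -T 1 else -1) +
    Pi.single x.1.succ (if x.2 then 1 else T (-1))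

/-- The row vector of `burauGen x - 1`. -/
noncomputable def burauRow {k : ℕ} (i : Fin k) : Fin (k + 1) → ℤ[T;T⁻¹] :=
  Pi.single i.castSucc 1 - Pi.single i.succ 1

theorem T_one_mul_T_neg_one : (T 1 : ℤ[T;T⁻¹]) * T (-1) = 1 := by
  rw [← T_add]; simp

theorem T_neg_one_mul_T_one : (T (-1) : ℤ[T;T⁻¹]) * T 1 = 1 := by
  rw [← T_add]; simp

theorem T_ne_zero (m : ℤ) : (T m : ℤ[T;T⁻¹]) ≠ 0 := (isUnit_T m).ne_zero

/-- With this rank-one form the inverse and braid relations only involve the scalars `burauRow i ⬝ᵥ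
burauCol x`. -/
theorem burauGen_eq {k : ℕ} (x : Fin k × Bool) :
    burauGen x = 1 + Matrix.vecMulVec (burauCol x) (burauRow x.1) := by
  have h : x.1.succ ≠ x.1.castSucc := Fin.castSucc_lt_succ.ne'
  ext1 p q
  simp only [burauGen, burauCol, burauRow, Matrix.of_apply, Matrix.add_apply, Matrix.one_apply,
    Matrix.vecMulVec_apply, Pi.add_apply, Pi.sub_apply, Pi.single_apply]
  rcases eq_or_ne p x.1.castSucc with rfl | h1
  · rcases eq_or_ne q x.1.castSucc with rfl | h2
    · cases x.2 <;> simp [h.symm, sub_eq_add_neg]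
    · rcases eq_or_ne q x.1.succ with rfl | h3
      · cases x.2 <;> simp [h, h.symm]
      · simp [h2, h3, h2.symm]
  · rcases eq_or_ne p x.1.succ with rfl | h4
    · rcases eq_or_ne q x.1.castSucc with rfl | h2
      · cases x.2 <;> simp [h, h.symm]
      · rcases eq_or_ne q x.1.succ with rfl | h3
        · cases x.2 <;> simp [h, sub_eq_add_neg]
        · simp [h2, h3, h3.symm, h]
    · simp [h1, h4]

theorem burauRow_dotProduct_burauCol {k : ℕ} (i : Fin k) (e : Bool) :
    burauRow i ⬝ᵥ burauCol (i, e) = if e then -T 1 - 1 else -1 - T (-1) := by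
  have h : i.succ ≠ i.castSucc := Fin.castSucc_lt_succ.ne'
  simp [burauRow, burauCol, h, h.symm]
  cases e <;> simp [sub_eq_add_neg]

theorem burauRow_dotProduct_burauCol_succ {k : ℕ} (i j : Fin k) (hij : (i : ℕ) + 1 = j) :
    burauRow i ⬝ᵥ burauCol (j, true) = T 1 ∧ burauRow j ⬝ᵥ burauCol (i, true) = 1 := by
  have h1 : i.succ = j.castSucc := by ext; simp [hij]
  have h2 : i.castSucc ≠ j.castSucc := by intro h; have := congrArg Fin.val h; simp at this; omega
  have h3 : i.castSucc ≠ j.succ := by intro h; have := congrArg Fin.val h; simp at this; omega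
  have h4 : j.castSucc ≠ j.succ := Fin.castSucc_lt_succ.ne
  constructor
  · simp [burauRow, burauCol, h1, h2, h3, h4]
  · simp [burauRow, burauCol, h1, h2, h3, h4]

theorem burauRow_dotProduct_burauCol_of_lt {k : ℕ} (i j : Fin k) (hij : (i : ℕ) + 1 < j)
    (e : Bool) :
    burauRow i ⬝ᵥ burauCol (j, e) = 0 ∧ burauRow j ⬝ᵥ burauCol (i, e) = 0 := by
  have h1 : i.succ ≠ j.castSucc := by intro h; have := congrArg Fin.val h; simp at this; omega
  have h2 : i.castSucc ≠ j.castSucc := by intro h; have := congrArg Fin.val h; simp at this; omega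
  have h3 : i.castSucc ≠ j.succ := by intro h; have := congrArg Fin.val h; simp at this; omega
  have h4 : i.succ ≠ j.succ := by intro h; have := congrArg Fin.val h; simp at this; omega
  constructor
  · simp [burauRow, burauCol, h1, h2, h3, h4]
  · simp [burauRow, burauCol, h1.symm, h2.symm, h3.symm, h4.symm]

theorem burauGen_mul_burauGen_not {k : ℕ} (i : Fin k) (e : Bool) :
    burauGen (i, e) * burauGen (i, !e) = 1 := by
  have hd := burauRow_dotProduct_burauCol i
  have hc : burauCol (i, true) = (T 1 : ℤ[T;T⁻¹]) • burauCol (i, false) := by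
    ext1 p
    simp only [burauCol, Pi.add_apply, Pi.smul_apply, Pi.single_apply, smul_eq_mul]
    have := T_one_mul_T_neg_one
    simp only [if_true, Bool.false_eq_true, if_false, mul_add, mul_ite, mul_neg, mul_one, mul_zero,
      this]
  have h1 := T_one_mul_T_neg_one
  rw [burauGen_eq, burauGen_eq]
  cases e
  · simp only [Bool.not_false, mul_add, add_mul, one_mul, mul_one, Matrix.vecMulVec_mul_vecMulVec,
      hc]
    ext1 p q
    simp only [Matrix.add_apply, Matrix.vecMulVec_apply, Pi.smul_apply, smul_eq_mul,
      dotProduct_smul, hd]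
    simp
    linear_combination -burauCol (i, false) p * burauRow i q * h1
  · simp only [Bool.not_true, mul_add, add_mul, one_mul, mul_one, Matrix.vecMulVec_mul_vecMulVec,
      hd, hc]
    ext1 p q
    simp only [Matrix.add_apply, Matrix.vecMulVec_apply, Pi.smul_apply, smul_eq_mul]
    simp
    linear_combination -burauCol (i, false) p * burauRow i q * h1

/-- The Burau matrix of a generator, as a unit. -/
noncomputable def burauUnit {k : ℕ} (i : Fin k) :
    (Matrix (Fin (k + 1)) (Fin (k + 1)) ℤ[T;T⁻¹])ˣ :=
  ⟨burauGen (i, true), burauGen (i, false), burauGen_mul_burauGen_not i true,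
    burauGen_mul_burauGen_not i false⟩

theorem burauUnit_commute {k : ℕ} (i j : Fin k) (hij : (i : ℕ) + 1 < j) :
    burauUnit i * burauUnit j = burauUnit j * burauUnit i := by
  obtain ⟨h1, h2⟩ := burauRow_dotProduct_burauCol_of_lt i j hij true
  ext1
  simp only [burauUnit, Units.val_mul, burauGen_eq, mul_add, add_mul, one_mul, mul_one,
    Matrix.vecMulVec_mul_vecMulVec, h1, h2, zero_smul, Matrix.vecMulVec_zero]
  abel

theorem burauUnit_braid {k : ℕ} (i j : Fin k) (hij : (i : ℕ) + 1 = j) :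
    burauUnit i * burauUnit j * burauUnit i = burauUnit j * burauUnit i * burauUnit j := by
  obtain ⟨h1, h2⟩ := burauRow_dotProduct_burauCol_succ i j hij
  have h3 := burauRow_dotProduct_burauCol i true
  have h4 := burauRow_dotProduct_burauCol j true
  ext1
  simp only [burauUnit, Units.val_mul, burauGen_eq, mul_add, add_mul, one_mul, mul_one,
    Matrix.vecMulVec_mul_vecMulVec, h1, h2, h3, h4]
  ext1 p q
  simp only [Matrix.add_apply, Matrix.vecMulVec_apply, Pi.smul_apply, smul_eq_mul, smul_dotProduct,
    h1, h2, if_true]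
  ring

/-- The Burau representation of the braid group. -/
noncomputable def burauHom (k : ℕ) :
    BraidGroup k →* (Matrix (Fin (k + 1)) (Fin (k + 1)) ℤ[T;T⁻¹])ˣ :=
  PresentedGroup.toGroup (f := burauUnit) (by
    rintro _ (⟨i, j, hij, rfl⟩ | ⟨i, j, hij, rfl⟩)
    · simp [burauUnit_commute i j hij]
    · simp [burauUnit_braid i j hij])

theorem burauHom_toBraid {k : ℕ} (w : BraidWord k) :
    ((burauHom k w.toBraid : (Matrix (Fin (k + 1)) (Fin (k + 1)) ℤ[T;T⁻¹])ˣ) :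
      Matrix (Fin (k + 1)) (Fin (k + 1)) ℤ[T;T⁻¹]) = burau w := by
  have : burauHom k w.toBraid = FreeGroup.lift burauUnit (FreeGroup.mk w) := rfl
  rw [this, FreeGroup.lift_mk, ← Units.coeHom_apply, map_list_prod, burau, List.map_map]
  congr 2
  ext1 ⟨i, e⟩
  cases e <;> rfl

theorem burau_append {k : ℕ} (u v : BraidWord k) : burau (u ++ v) = burau u * burau v := by
  simp [burau]

theorem burau_cons {k : ℕ} (x : Fin k × Bool) (v : BraidWord k) :
    burau (x :: v) = burauGen x * burau v := by
  simp [burau]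

theorem isUnit_burau {k : ℕ} (w : BraidWord k) : IsUnit (burau w) := by
  rw [← burauHom_toBraid]; exact Units.isUnit _

theorem det_burau_ne_zero {k : ℕ} (w : BraidWord k) : (burau w).det ≠ 0 :=
  ((Matrix.isUnit_iff_isUnit_det _).1 (isUnit_burau w)).ne_zero

/-! ### Fixed vectors and the reduced determinant -/

/-- The row vector `(1, t, t², …)` fixed by the Burau representation. -/
noncomputable def powVec (k : ℕ) : Fin (k + 1) → ℤ[T;T⁻¹] := fun i => T (i : ℕ)

theorem burau_mulVec_one {k : ℕ} (w : BraidWord k) : burau w *ᵥ 1 = 1 := by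
  induction w with
  | nil => simp [burau]
  | cons x w ih =>
    rw [burau_cons, ← Matrix.mulVec_mulVec, ih, burauGen_eq, Matrix.add_mulVec, Matrix.one_mulVec,
      Matrix.vecMulVec_mulVec]
    simp [burauRow]

theorem powVec_vecMul_burau {k : ℕ} (w : BraidWord k) : powVec k ᵥ* burau w = powVec k := by
  induction w with
  | nil => simp [burau]
  | cons x w ih =>
    have h : powVec k ⬝ᵥ burauCol x = 0 := by
      have h2 : (T ((x.1.succ : ℕ) : ℤ) : ℤ[T;T⁻¹]) = T ((x.1.castSucc : ℕ) : ℤ) * T 1 := by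
        rw [← T_add]; simp
      have := T_one_mul_T_neg_one
      simp only [burauCol, powVec, dotProduct_add, dotProduct_single]
      cases x.2
      · rw [h2, mul_assoc]; simp only [Bool.false_eq_true, if_false, this]; ring
      · rw [h2]; simp only [if_true]; ring
    rw [burau_cons, ← Matrix.vecMul_vecMul, burauGen_eq, Matrix.vecMul_add, Matrix.vecMul_one,
      Matrix.vecMul_vecMulVec, h]
    simp [ih]

/-- The columns add up to zero, so deleting another column changes a minor only by a sign, and the
cofactor sign cancels it. -/
theorem adjugate_apply_eq_of_row_sum {R : Type*} [CommRing R] {k : ℕ}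
    (M : Matrix (Fin (k + 1)) (Fin (k + 1)) R) (h : ∀ i, ∑ j, M i j = 0) (i j : Fin (k + 1)) :
    M.adjugate i j = M.adjugate 0 j := by
  have := Matrix.submatrix_succAbove_det_eq_negOnePow_submatrix_succAbove_det'
    (M.submatrix j.succAbove id) (fun a => h _) i 0
  simp only [Matrix.submatrix_submatrix, Function.comp_id, Function.id_comp] at this
  rw [Matrix.adjugate_fin_succ_eq_det_submatrix, Matrix.adjugate_fin_succ_eq_det_submatrix, this]
  simp [Int.negOnePow_def, pow_add, Units.smul_def, zsmul_eq_mul, mul_assoc,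
    ← mul_assoc ((-1 : R) ^ (i : ℕ)), ← mul_pow]

/-- The determinant of `burau w - 1` with first row and column deleted. -/
noncomputable def reducedDet {k : ℕ} (w : BraidWord k) : ℤ[T;T⁻¹] := (burau w - 1).adjugate 0 0

theorem det_diagonal_powVec_ne_zero (k : ℕ) : (Matrix.diagonal (powVec k)).det ≠ 0 := by
  rw [Matrix.det_diagonal, Finset.prod_ne_zero_iff]
  exact fun i _ => T_ne_zero _

/-- The column of ones in the kernel makes the rows of the adjugate equal. The same argument for the
transpose, rescaled so that its kernel vector `powVec` becomes the vector of ones, makes its columns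
proportional to the entries of `powVec`. -/
theorem adjugate_burau_sub_one {k : ℕ} (w : BraidWord k) :
    (burau w - 1).adjugate = reducedDet w • Matrix.vecMulVec 1 (powVec k) := by
  set M := burau w - 1 with hM
  have h1 : ∀ i, ∑ j, M i j = 0 := by
    intro i
    have := congrFun (burau_mulVec_one w) i
    simp only [Matrix.mulVec, dotProduct, Pi.one_apply, mul_one] at this
    simp [hM, Finset.sum_sub_distrib, this, Matrix.one_apply]
  set N := M.transpose * Matrix.diagonal (powVec k) with hN
  have h2 : ∀ i, ∑ j, N i j = 0 := by
    intro i
    have := congrFun (powVec_vecMul_burau w) i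
    simp only [Matrix.vecMul, dotProduct] at this
    simp only [hN, Matrix.mul_diagonal, Matrix.transpose_apply, hM, Matrix.sub_apply, sub_mul,
      Finset.sum_sub_distrib, Matrix.one_apply, ite_mul, one_mul, zero_mul,
      Finset.sum_ite_eq', Finset.mem_univ, if_true]
    rw [← this]
    simp [mul_comm]
  have h3 : Matrix.diagonal (powVec k) * N.adjugate =
      (Matrix.diagonal (powVec k)).det • M.adjugate.transpose := by
    rw [hN, Matrix.adjugate_mul_distrib, ← mul_assoc, Matrix.mul_adjugate,
      Matrix.adjugate_transpose]
    simp
  have h4 : ∀ i, M.adjugate 0 i = powVec k i * M.adjugate 0 0 := by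
    intro i
    have e1 := congrFun (congrFun h3 i) 0
    have e2 := congrFun (congrFun h3 0) 0
    simp only [Matrix.diagonal_mul, Matrix.smul_apply, Matrix.transpose_apply, smul_eq_mul] at e1 e2
    rw [adjugate_apply_eq_of_row_sum N h2 i 0] at e1
    have e3 : powVec k 0 = 1 := by simp [powVec]
    rw [e3, one_mul] at e2
    rw [e2] at e1
    apply mul_left_cancel₀ (det_diagonal_powVec_ne_zero k)
    rw [← e1]; ring
  ext1 i j
  rw [adjugate_apply_eq_of_row_sum M h1, h4, Matrix.smul_apply, Matrix.vecMulVec_apply, reducedDet]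
  simp [mul_comm, ← hM]

theorem associated_minor {k : ℕ} (w : BraidWord k) (i j : Fin (k + 1)) :
    Associated ((burau w - 1).submatrix i.succAbove j.succAbove).det (reducedDet w) := by
  have h := congrFun (congrFun (adjugate_burau_sub_one w) j) i
  rw [Matrix.adjugate_fin_succ_eq_det_submatrix, Matrix.smul_apply, Matrix.vecMulVec_apply] at h
  simp only [Pi.one_apply, one_mul, smul_eq_mul] at h
  have hu : IsUnit ((-1 : ℤ[T;T⁻¹]) ^ (i + j : ℕ)) := (isUnit_one.neg).pow _
  refine (associated_unit_mul_left _ _ hu).symm.trans ?_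
  rw [h]
  exact associated_mul_unit_left _ _ (isUnit_T _)

/-- `burau u` intertwines the two matrices. After taking adjugates it disappears, because it fixes
both vectors of the rank-one form and its determinant can be cancelled; no division is needed. -/
theorem reducedDet_append_comm {k : ℕ} (u v : BraidWord k) :
    reducedDet (u ++ v) = reducedDet (v ++ u) := by
  have h : (burau (u ++ v) - 1) * burau u = burau u * (burau (v ++ u) - 1) := by
    simp [burau_append, sub_mul, mul_sub, mul_assoc]
  have h2 : burau u * ((burau (u ++ v) - 1) * burau u).adjugate * burau u =
      burau u * (burau u * (burau (v ++ u) - 1)).adjugate * burau u := by rw [h]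
  rw [Matrix.adjugate_mul_distrib, Matrix.adjugate_mul_distrib, ← mul_assoc, Matrix.mul_adjugate,
    ← mul_assoc, mul_assoc _ (burau u).adjugate, Matrix.adjugate_mul, mul_assoc, adjugate_burau_sub_one,
    adjugate_burau_sub_one] at h2
  have h3 := congrFun (congrFun h2 0) 0
  simp only [Matrix.smul_mul, Matrix.mul_smul, mul_one, Matrix.vecMulVec_mul,
    powVec_vecMul_burau, Matrix.mul_vecMulVec, burau_mulVec_one, Matrix.smul_apply,
    Matrix.vecMulVec_apply, smul_eq_mul, powVec] at h3
  simpa [det_burau_ne_zero, Matrix.smul_mulVec, mul_comm (reducedDet _)] using h3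

/-! ### Markov invariance of the reduced determinant -/

theorem burauGen_addRight {k : ℕ} (x : Fin k × Bool) (i : Fin (k + 1)) :
    (∀ j : Fin (k + 1), burauGen (x.1.castSucc, x.2) i.castSucc j.castSucc = burauGen x i j) ∧
    burauGen (x.1.castSucc, x.2) i.castSucc (Fin.last (k + 1)) = 0 := by
  have h : Fin.last (k + 1) ≠ x.1.castSucc.castSucc := (Fin.castSucc_lt_last _).ne'
  have h' : Fin.last (k + 1) ≠ x.1.succ.castSucc := (Fin.castSucc_lt_last _).ne'
  have h2 : i.castSucc ≠ Fin.last (k + 1) := (Fin.castSucc_lt_last _).ne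
  constructor
  · intro j
    simp only [burauGen, Matrix.of_apply, Fin.succ_castSucc, Fin.castSucc_inj]
  · simp only [burauGen, Matrix.of_apply, Fin.succ_castSucc, Fin.castSucc_inj, h, h', h2, if_false,
      ite_self]

theorem burau_addRight {k : ℕ} (w : BraidWord k) (i : Fin (k + 1)) :
    (∀ j : Fin (k + 1), burau w.addRight i.castSucc j.castSucc = burau w i j) ∧
    burau w.addRight i.castSucc (Fin.last (k + 1)) = 0 := by
  induction w generalizing i with
  | nil =>
    simp [burau, BraidWord.addRight, Matrix.one_apply]
  | cons x w ih =>
    have e : BraidWord.addRight (x :: w) = (x.1.castSucc, x.2) :: BraidWord.addRight w := rfl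
    rw [e, burau_cons, burau_cons]
    constructor
    · intro j
      rw [Matrix.mul_apply, Fin.sum_univ_castSucc, (burauGen_addRight x i).2, Matrix.mul_apply]
      simp [(burauGen_addRight x i).1, (ih _).1]
    · rw [Matrix.mul_apply, Fin.sum_univ_castSucc, (burauGen_addRight x i).2]
      simp [(ih _).2]

theorem burauGen_addLeft {k : ℕ} (x : Fin k × Bool) (i : Fin (k + 1)) :
    (∀ j : Fin (k + 1), burauGen (x.1.succ, x.2) i.succ j.succ = burauGen x i j) ∧
    burauGen (x.1.succ, x.2) i.succ 0 = 0 := by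
  have h : (0 : Fin (k + 2)) ≠ x.1.succ.castSucc := by
    rw [← Fin.succ_castSucc]; exact (Fin.succ_ne_zero _).symm
  have h' : (0 : Fin (k + 2)) ≠ x.1.succ.succ := (Fin.succ_ne_zero _).symm
  have h2 : i.succ ≠ 0 := Fin.succ_ne_zero _
  constructor
  · intro j
    simp only [burauGen, Matrix.of_apply, ← Fin.succ_castSucc, Fin.succ_inj]
  · simp only [burauGen, Matrix.of_apply, h, h', h2, if_false, ite_self]

theorem burau_addLeft {k : ℕ} (w : BraidWord k) (i : Fin (k + 1)) :
    (∀ j : Fin (k + 1), burau w.addLeft i.succ j.succ = burau w i j) ∧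
    burau w.addLeft i.succ 0 = 0 := by
  induction w generalizing i with
  | nil =>
    simp [burau, BraidWord.addLeft, Matrix.one_apply]
  | cons x w ih =>
    have e : BraidWord.addLeft (x :: w) = (x.1.succ, x.2) :: BraidWord.addLeft w := rfl
    rw [e, burau_cons, burau_cons]
    constructor
    · intro j
      rw [Matrix.mul_apply, Fin.sum_univ_succ, (burauGen_addLeft x i).2, Matrix.mul_apply]
      simp [(burauGen_addLeft x i).1, (ih _).1]
    · rw [Matrix.mul_apply, Fin.sum_univ_succ, (burauGen_addLeft x i).2]
      simp [(ih _).2]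

theorem burau_singleton {k : ℕ} (x : Fin k × Bool) : burau [x] = burauGen x := by
  simp [burau]

theorem mul_burauGen_apply {k : ℕ} (M : Matrix (Fin (k + 1)) (Fin (k + 1)) ℤ[T;T⁻¹])
    (x : Fin k × Bool) (i j : Fin (k + 1)) :
    (M * burauGen x) i j = M i j + (M *ᵥ burauCol x) i * burauRow x.1 j := by
  rw [burauGen_eq, mul_add, mul_one, Matrix.mul_vecMulVec, Matrix.add_apply, Matrix.vecMulVec_apply]

/-- Replacing the column `i` of `B - 1` by a multiple of the column `i` of `B`. -/
theorem det_updateCol_sub_one {k : ℕ} (w : BraidWord k) (i : Fin (k + 1)) (c : ℤ[T;T⁻¹]) :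
    ((burau w - 1).updateCol i (fun a => c * burau w a i)).det =
      c * T (i : ℕ) * reducedDet w := by
  -- The new column is c((B - 1)e_i + e_i). By Cramer's rule the first summand contributes a
  -- multiple of det(B - 1) = 0 and the second the i-th diagonal entry of the adjugate.
  have h1 : (fun a => c * burau w a i) =
      c • ((burau w - 1) *ᵥ Pi.single i 1 + Pi.single i 1) := by
    ext1 a
    simp [Matrix.one_apply, Pi.single_apply]
  have h2 : (burau w - 1).det = 0 := by
    refine Matrix.exists_mulVec_eq_zero_iff.1 ⟨1, one_ne_zero, ?_⟩
    rw [Matrix.sub_mulVec, burau_mulVec_one, Matrix.one_mulVec, sub_self]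
  rw [← Matrix.cramer_apply, Matrix.cramer_eq_adjugate_mulVec, h1, Matrix.mulVec_smul,
    Matrix.mulVec_add, Matrix.mulVec_mulVec, Matrix.adjugate_mul, h2, adjugate_burau_sub_one]
  simp [powVec]
  ring

/-- Delete the row of the new strand and the column of its neighbour. The column of the new strand
then takes the neighbour's place and is a unit multiple of the last column of `burau w`, while the
other columns are those of `burau w - 1`. -/
theorem associated_reducedDet_addRight {k : ℕ} (w : BraidWord k) (e : Bool) :
    Associated (reducedDet (w.addRight ++ [(Fin.last k, e)])) (reducedDet w) := by
  have hl : (Fin.last k).succ = Fin.last (k + 1) := rfl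
  set c : ℤ[T;T⁻¹] := if e then T 1 else 1 with hc
  have hcu : IsUnit c := by cases e <;> simp [hc, isUnit_T]
  have key : ((burau (w.addRight ++ [(Fin.last k, e)]) - 1).submatrix
      (Fin.last (k + 1)).succAbove (Fin.last k).castSucc.succAbove) =
      (burau w - 1).updateCol (Fin.last k) (fun a => c * burau w a (Fin.last k)) := by
    have hmv : ∀ i : Fin (k + 1), (burau w.addRight *ᵥ burauCol (Fin.last k, e)) i.castSucc =
        -c * burau w i (Fin.last k) := by
      intro i
      simp only [burauCol, Matrix.mulVec_add, Matrix.mulVec_single, Pi.add_apply, hl,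
        Pi.smul_apply, Matrix.col_apply, (burau_addRight w i).2, (burau_addRight w i).1]
      cases e <;> simp [hc, mul_comm]
    ext1 i j
    rw [Matrix.submatrix_apply, Fin.succAbove_last, Matrix.sub_apply, burau_append, burau_singleton,
      mul_burauGen_apply, hmv]
    rcases Fin.eq_castSucc_or_eq_last j with ⟨j, rfl⟩ | rfl
    · have hj : (Fin.last k).castSucc.succAbove j.castSucc = j.castSucc.castSucc :=
        Fin.succAbove_of_castSucc_lt _ _ (by simp [Fin.lt_def])
      rw [hj, (burau_addRight w i).1, Matrix.updateCol_ne (Fin.castSucc_lt_last j).ne]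
      have h1 : j.castSucc.castSucc ≠ Fin.last (k + 1) := (Fin.castSucc_lt_last _).ne
      have h2 : j.castSucc ≠ Fin.last k := (Fin.castSucc_lt_last _).ne
      simp only [burauRow, Pi.sub_apply, hl, Pi.single_apply, Fin.castSucc_inj, h1, h2, if_false,
        Matrix.sub_apply, Matrix.one_apply]
      ring
    · have hj : (Fin.last k).castSucc.succAbove (Fin.last k) = Fin.last (k + 1) := by
        rw [Fin.succAbove_of_le_castSucc _ _ le_rfl, hl]
      rw [hj, (burau_addRight w i).2, Matrix.updateCol_self, Matrix.one_apply_ne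
        (Fin.castSucc_lt_last i).ne]
      have h1 : Fin.last (k + 1) ≠ (Fin.last k).castSucc := (Fin.castSucc_lt_last _).ne'
      simp only [burauRow, Pi.sub_apply, hl, Pi.single_apply, h1, if_true, if_false]
      ring
  refine (associated_minor _ (Fin.last (k + 1)) (Fin.last k).castSucc).symm.trans ?_
  rw [key, det_updateCol_sub_one]
  exact associated_unit_mul_left _ _ (hcu.mul (isUnit_T _))

theorem associated_reducedDet_addLeft {k : ℕ} (w : BraidWord k) (e : Bool) :
    Associated (reducedDet (w.addLeft ++ [((0 : Fin (k + 1)), e)])) (reducedDet w) := by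
  set c : ℤ[T;T⁻¹] := if e then 1 else T (-1) with hc
  have hcu : IsUnit c := by cases e <;> simp [hc, isUnit_T]
  have hz : (0 : Fin (k + 1)).castSucc = 0 := rfl
  have key : ((burau (w.addLeft ++ [((0 : Fin (k + 1)), e)]) - 1).submatrix
      (0 : Fin (k + 2)).succAbove (0 : Fin (k + 1)).succ.succAbove) =
      (burau w - 1).updateCol 0 (fun a => c * burau w a 0) := by
    have hmv : ∀ i : Fin (k + 1), (burau w.addLeft *ᵥ burauCol ((0 : Fin (k + 1)), e)) i.succ =
        c * burau w i 0 := by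
      intro i
      simp only [burauCol, Matrix.mulVec_add, Matrix.mulVec_single, Pi.add_apply, hz,
        Pi.smul_apply, Matrix.col_apply, (burau_addLeft w i).2, (burau_addLeft w i).1]
      cases e <;> simp [hc]
    ext1 i j
    rw [Matrix.submatrix_apply, Fin.succAbove_zero, Matrix.sub_apply, burau_append, burau_singleton,
      mul_burauGen_apply, hmv]
    rcases Fin.eq_zero_or_eq_succ j with rfl | ⟨j, rfl⟩
    · have hj : (0 : Fin (k + 1)).succ.succAbove 0 = 0 := by
        rw [Fin.succAbove_of_castSucc_lt _ _ (by simp)]; rfl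
      rw [hj, (burau_addLeft w i).2, Matrix.updateCol_self, Matrix.one_apply_ne
        (Fin.succ_ne_zero i)]
      have h1 : (0 : Fin (k + 2)) ≠ (0 : Fin (k + 1)).succ := (Fin.succ_ne_zero _).symm
      simp only [burauRow, Pi.sub_apply, hz, Pi.single_apply, h1, if_true, if_false]
      ring
    · have hj : (0 : Fin (k + 1)).succ.succAbove j.succ = j.succ.succ :=
        Fin.succAbove_of_le_castSucc _ _ (by simp [Fin.le_def])
      rw [hj, (burau_addLeft w i).1, Matrix.updateCol_ne (Fin.succ_ne_zero j)]
      have h1 : j.succ.succ ≠ 0 := Fin.succ_ne_zero _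
      have h2 : j.succ ≠ 0 := Fin.succ_ne_zero _
      simp only [burauRow, Pi.sub_apply, hz, Pi.single_apply, Fin.succ_inj, h1, h2, if_false,
        Matrix.sub_apply, Matrix.one_apply]
      ring
  refine (associated_minor _ 0 (0 : Fin (k + 1)).succ).symm.trans ?_
  rw [key, det_updateCol_sub_one]
  exact associated_unit_mul_left _ _ (hcu.mul (isUnit_T _))

theorem MarkovMove.associated_reducedDet {p q : Σ k : ℕ, BraidWord k} (h : MarkovMove p q) :
    Associated (reducedDet p.2) (reducedDet q.2) := by
  cases h with
  | braid w w' h =>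
    simp only [reducedDet]
    rw [← burauHom_toBraid w, ← burauHom_toBraid w', h]
  | conj u v => rw [reducedDet_append_comm u v]
  | @destabLast k u v e =>
    dsimp only
    -- Conjugation moves the letter to be removed to the end of the word.
    rw [reducedDet_append_comm, ← List.append_assoc, reducedDet_append_comm u v]
    have : v.addRight ++ u.addRight = BraidWord.addRight (v ++ u) := by simp [BraidWord.addRight]
    rw [this]
    exact associated_reducedDet_addRight _ _
  | @destabFirst k u v e =>
    dsimp only
    rw [reducedDet_append_comm, ← List.append_assoc, reducedDet_append_comm u v]
    have : v.addLeft ++ u.addLeft = BraidWord.addLeft (v ++ u) := by simp [BraidWord.addLeft]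
    rw [this]
    exact associated_reducedDet_addLeft _ _

theorem associated_reducedDet_of_closure_eq {k k' : ℕ} {w : BraidWord k} {w' : BraidWord k'}
    (h : w.closure = w'.closure) : Associated (reducedDet w) (reducedDet w') := by
  have := Quot.eqvGen_exact h
  generalize hp : (⟨k, w⟩ : Σ k : ℕ, BraidWord k) = p at this
  generalize hq : (⟨k', w'⟩ : Σ k : ℕ, BraidWord k) = q at this
  suffices Associated (reducedDet p.2) (reducedDet q.2) by subst hp hq; exact this
  clear hp hq h
  induction this with
  | rel _ _ h => exact h.associated_reducedDet
  | refl _ => exact Associated.refl _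
  | symm _ _ _ ih => exact ih.symm
  | trans _ _ _ _ _ ih1 ih2 => exact ih1.trans ih2

/-! ### Fox calculus and the Alexander matrix -/

/-- The unit `t` of the ring of Laurent polynomials. -/
noncomputable def unitT : ℤ[T;T⁻¹]ˣ := ⟨T 1, T (-1), T_one_mul_T_neg_one, T_neg_one_mul_T_one⟩

/-- The augmentation of a free group that maps every generator to `t`. -/
noncomputable def augment (m : ℕ) : FreeGroup (Fin m) →* ℤ[T;T⁻¹]ˣ :=
  FreeGroup.lift fun _ => unitT

theorem augment_of {m : ℕ} (i : Fin m) : augment m (FreeGroup.of i) = unitT := by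
  simp [augment]

theorem augment_cons {m : ℕ} (x : Fin m × Bool) (w : List (Fin m × Bool)) :
    ((augment m (FreeGroup.mk (x :: w)) : ℤ[T;T⁻¹]ˣ) : ℤ[T;T⁻¹]) =
      (if x.2 then (T 1 : ℤ[T;T⁻¹]) else T (-1)) *
        ((augment m (FreeGroup.mk w) : ℤ[T;T⁻¹]ˣ) : ℤ[T;T⁻¹]) := by
  rcases x with ⟨i, e⟩
  cases e <;> simp [augment, unitT]

theorem foxWord_append {m : ℕ} (j : Fin m) (u v : List (Fin m × Bool)) :
    foxWord j (u ++ v) = foxWord j u + ((augment m (FreeGroup.mk u) : ℤ[T;T⁻¹]ˣ) : ℤ[T;T⁻¹]) * foxWord j v := by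
  induction u with
  | nil => simp [foxWord, ← FreeGroup.one_eq_mk]
  | cons x u ih =>
    rcases x with ⟨i, e⟩
    rw [augment_cons]
    cases e
    · simp only [List.cons_append, foxWord, ih, Bool.false_eq_true, if_false]; ring
    · simp only [List.cons_append, foxWord, ih, if_true]; ring

/-- A cancelling pair of letters has Fox derivative 0 and augmentation 1, so `fox` may be computed
on unreduced words. -/
theorem foxWord_eq_of_red {m : ℕ} (j : Fin m) {u v : List (Fin m × Bool)}
    (h : FreeGroup.Red u v) : foxWord j u = foxWord j v := by
  induction h with
  | refl => rfl
  | tail _ h ih =>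
    rw [ih]
    cases h with
    | @not L₁ L₂ i e =>
      rw [foxWord_append, foxWord_append]
      congr 2
      cases e <;> simp only [Bool.not_true, Bool.not_false, foxWord] <;> split_ifs <;>
        simp only [mul_add, mul_neg, ← mul_assoc, T_one_mul_T_neg_one, T_neg_one_mul_T_one] <;>
        ring

theorem fox_mk {m : ℕ} (j : Fin m) (u : List (Fin m × Bool)) :
    fox j (FreeGroup.mk u) = foxWord j u := by
  rw [fox, FreeGroup.toWord_mk]
  exact (foxWord_eq_of_red j FreeGroup.reduce.red).symm

theorem fox_mul {m : ℕ} (j : Fin m) (g h : FreeGroup (Fin m)) :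
    fox j (g * h) = fox j g + augment m g * fox j h := by
  rw [← FreeGroup.mk_toWord (x := g), ← FreeGroup.mk_toWord (x := h), FreeGroup.mul_mk, fox_mk,
    fox_mk, fox_mk, foxWord_append]

theorem fox_one {m : ℕ} (j : Fin m) : fox j 1 = 0 := by
  rw [FreeGroup.one_eq_mk, fox_mk, foxWord]

theorem fox_of {m : ℕ} (j i : Fin m) : fox j (FreeGroup.of i) = if i = j then 1 else 0 := by
  rw [FreeGroup.of, fox_mk]; simp [foxWord]

theorem fox_inv {m : ℕ} (j : Fin m) (g : FreeGroup (Fin m)) :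
    fox j g⁻¹ = -((augment m g)⁻¹ : ℤ[T;T⁻¹]ˣ) * fox j g := by
  have h := fox_mul j g⁻¹ g
  rw [inv_mul_cancel, fox_one, map_inv] at h
  linear_combination -h

/-- Chain rule of the Fox calculus; preservation of the augmentation keeps the outer derivatives
unchanged under substitution. -/
theorem fox_hom {m m' : ℕ} (φ : FreeGroup (Fin m) →* FreeGroup (Fin m'))
    (hφ : (augment m').comp φ = augment m) (j : Fin m') (g : FreeGroup (Fin m)) :
    fox j (φ g) = ∑ i, fox i g * fox j (φ (FreeGroup.of i)) := by
  have ha : ∀ g, augment m' (φ g) = augment m g := fun g => by rw [← hφ]; rfl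
  induction g using FreeGroup.induction_on with
  | C1 => simp [fox_one]
  | of i => simp [fox_of]
  | inv_of i _ => simp [fox_inv, fox_of, ha]
  | mul g h ih1 ih2 =>
    simp only [map_mul, fox_mul, ih1, ih2, ha, add_mul, Finset.sum_add_distrib, Finset.mul_sum,
      mul_assoc]

theorem augment_comp_artinGen {k : ℕ} (x : Fin k × Bool) :
    (augment (k + 1)).comp (artinGen x) = augment (k + 1) := by
  ext1 m
  simp only [artinGen, MonoidHom.comp_apply, FreeGroup.lift_apply_of]
  split_ifs <;> simp [augment_of]

theorem augment_comp_artin {k : ℕ} (w : BraidWord k) :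
    (augment (k + 1)).comp (artin w) = augment (k + 1) := by
  induction w with
  | nil => rfl
  | cons x w ih => rw [artin, ← MonoidHom.comp_assoc, augment_comp_artinGen, ih]

theorem fox_artinGen {k : ℕ} (x : Fin k × Bool) (i j : Fin (k + 1)) :
    fox j (artinGen x (FreeGroup.of i)) = burauGen x i j := by
  have h : x.1.succ ≠ x.1.castSucc := Fin.castSucc_lt_succ.ne'
  have h1 := T_neg_one_mul_T_one
  have h2 := T_one_mul_T_neg_one
  rcases x with ⟨a, e⟩
  simp only [artinGen, FreeGroup.lift_apply_of, burauGen, Matrix.of_apply, eq_comm (a := j)] at h ⊢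
  have h3 : ((unitT : ℤ[T;T⁻¹]ˣ) : ℤ[T;T⁻¹]) = T 1 := rfl
  have h4 : ((unitT⁻¹ : ℤ[T;T⁻¹]ˣ) : ℤ[T;T⁻¹]) = T (-1) := rfl
  generalize (T 1 : ℤ[T;T⁻¹]) = t at *
  generalize (T (-1) : ℤ[T;T⁻¹]) = t' at *
  cases e
  · simp only [Bool.false_eq_true, if_false]
    split_ifs <;> simp_all [fox_mul, fox_inv, fox_of, augment_of, sub_eq_add_neg, add_comm]
  · simp only [if_true]
    split_ifs <;> simp_all [fox_mul, fox_inv, fox_of, augment_of, sub_eq_add_neg, mul_assoc]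

/-- The Fox Jacobian of the Artin action of a braid word. -/
noncomputable def foxJacobian {k : ℕ} (w : BraidWord k) :
    Matrix (Fin (k + 1)) (Fin (k + 1)) ℤ[T;T⁻¹] :=
  Matrix.of fun i j => fox j (artin w (FreeGroup.of i))

/-- `artinGen x` is the outer map of the composition, so the chain rule puts its matrix on the
right. This is where the reversed word comes from. -/
theorem foxJacobian_cons {k : ℕ} (x : Fin k × Bool) (w : BraidWord k) :
    foxJacobian (x :: w) = foxJacobian w * burauGen x := by
  ext1 i j
  rw [foxJacobian, Matrix.of_apply, artin, MonoidHom.comp_apply,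
    fox_hom (artinGen x) (augment_comp_artinGen x), Matrix.mul_apply]
  simp only [fox_artinGen, foxJacobian, Matrix.of_apply]

theorem foxJacobian_eq {k : ℕ} (w : BraidWord k) : foxJacobian w = burau w.reverse := by
  induction w with
  | nil =>
    ext1 i j
    rw [foxJacobian, List.reverse_nil, burau, List.map_nil, List.prod_nil, Matrix.of_apply, artin,
      MonoidHom.id_apply, fox_of, Matrix.one_apply]
  | cons x w ih => rw [foxJacobian_cons, ih, List.reverse_cons, burau_append, burau_singleton]

theorem alexanderMatrix_eq {k : ℕ} (w : BraidWord k) :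
    alexanderMatrix w = burau w.reverse - 1 := by
  rw [← foxJacobian_eq]
  ext1 i j
  have h : augment (k + 1) (artin w (FreeGroup.of i)) = unitT := by
    rw [← augment_of i, ← DFunLike.congr_fun (augment_comp_artin w) (FreeGroup.of i)]; rfl
  simp only [alexanderMatrix, foxJacobian, Matrix.of_apply, Matrix.sub_apply, fox_mul, fox_inv,
    augment_of, h, fox_of, Matrix.one_apply]
  rw [neg_mul, mul_neg, ← mul_assoc, Units.mul_inv, one_mul, ← sub_eq_add_neg]

/-- Conjugation by diag(1, t, t², …) transposes the matrix of each letter, and transposition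
reverses products. -/
theorem diagonal_mul_burau_reverse {k : ℕ} (w : BraidWord k) :
    Matrix.diagonal (powVec k) * burau w.reverse =
      (burau w)ᵀ * Matrix.diagonal (powVec k) := by
  induction w with
  | nil => simp [burau]
  | cons x w ih =>
    have h : Matrix.diagonal (powVec k) * burauGen x =
        (burauGen x)ᵀ * Matrix.diagonal (powVec k) := by
      have h0 : x.1.succ ≠ x.1.castSucc := Fin.castSucc_lt_succ.ne'
      have h1 : powVec k x.1.succ = T 1 * powVec k x.1.castSucc := by
        simp only [powVec]; rw [← T_add]; simp [add_comm]
      have h2 := T_neg_one_mul_T_one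
      ext1 p q
      rw [Matrix.diagonal_mul, Matrix.mul_diagonal, Matrix.transpose_apply]
      rcases eq_or_ne p q with rfl | hpq
      · ring
      · simp only [burauGen, Matrix.of_apply]
        have := hpq.symm
        generalize (T 1 : ℤ[T;T⁻¹]) = t at *
        generalize (T (-1) : ℤ[T;T⁻¹]) = t' at *
        split_ifs <;> simp_all
        all_goals
          first
          | ring1
          | linear_combination (powVec k x.1.castSucc) * h2
          | linear_combination (-powVec k x.1.castSucc) * h2
    rw [List.reverse_cons, burau_append, burau_singleton, burau_cons, Matrix.transpose_mul,
      ← mul_assoc, ih, mul_assoc, h, mul_assoc]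

theorem reducedDet_reverse {k : ℕ} (w : BraidWord k) : reducedDet w.reverse = reducedDet w := by
  set D := Matrix.diagonal (powVec k) with hD
  have h : D * (burau w.reverse - 1) = (burau w - 1)ᵀ * D := by
    rw [mul_sub, diagonal_mul_burau_reverse]; simp [sub_mul, hD]
  have h2 : D * (D * (burau w.reverse - 1)).adjugate * D =
      D * ((burau w - 1)ᵀ * D).adjugate * D := by rw [h]
  rw [Matrix.adjugate_mul_distrib, Matrix.adjugate_mul_distrib, ← mul_assoc, mul_assoc _ _ D,
    Matrix.adjugate_mul, ← mul_assoc, Matrix.mul_adjugate, ← Matrix.adjugate_transpose] at h2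
  have h3 := congrFun (congrFun h2 0) 0
  have h4 : powVec k 0 = 1 := by simp [powVec]
  simp only [Matrix.mul_smul, mul_one, Matrix.smul_apply, hD, Matrix.diagonal_mul, h4, one_mul,
    Matrix.smul_mul, Matrix.mul_diagonal, Matrix.transpose_apply] at h3
  exact mul_left_cancel₀ (det_diagonal_powVec_ne_zero k) h3

theorem isAlexanderPolynomial_of_associated {k : ℕ} (w : BraidWord k) (D : ℤ[T;T⁻¹])
    (h : Associated (reducedDet w) D) : IsAlexanderPolynomial w.closure D := by
  intro k' w' hw p
  have h1 : ∀ i j : Fin (k' + 1), Associated ((alexanderMatrix w').submatrix i.succAbove j.succAbove).det D := by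
    intro i j
    rw [alexanderMatrix_eq]
    refine (associated_minor _ i j).trans ?_
    rw [reducedDet_reverse]
    exact (associated_reducedDet_of_closure_eq hw).trans h
  exact ⟨fun hp i j => (h1 i j).dvd_iff_dvd_right.2 hp, fun hp => (h1 0 0).dvd_iff_dvd_right.1 (hp 0 0)⟩

/-! ### The reduced determinant of the three-strand word -/

/-- The alternating geometric sum `1 - x + x² - ⋯ ± x^(n-1)`. -/
def altSum {R : Type*} [CommRing R] (x : R) (n : ℕ) : R := ∑ k ∈ Finset.range n, (-x) ^ k

theorem altSum_succ {R : Type*} [CommRing R] (x : R) (n : ℕ) :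
    altSum x (n + 1) = altSum x n + (-x) ^ n := Finset.sum_range_succ _ _

theorem altSum_succ' {R : Type*} [CommRing R] (x : R) (n : ℕ) :
    altSum x (n + 1) = 1 - x * altSum x n := by
  simp only [altSum, Finset.sum_range_succ', pow_succ, ← Finset.sum_mul]
  ring

theorem burau_replicate {k : ℕ} (i : Fin k) (e : Bool) (n : ℕ) :
    burau (List.replicate n (i, e)) = 1 + altSum (if e then T 1 else T (-1) : ℤ[T;T⁻¹]) n •
      Matrix.vecMulVec (burauCol (i, e)) (burauRow i) := by
  induction n with
  | zero => simp [burau, altSum]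
  | succ n ih =>
    have h := burauRow_dotProduct_burauCol i e
    have h2 : burauRow i ⬝ᵥ burauCol (i, e) = -(if e then T 1 else T (-1) : ℤ[T;T⁻¹]) - 1 := by
      rw [h]; cases e <;> simp only [if_true, Bool.false_eq_true, if_false]; ring
    rw [List.replicate_succ, burau_cons, ih, burauGen_eq, altSum_succ']
    simp only [mul_add, add_mul, one_mul, mul_one, Matrix.mul_smul, Matrix.vecMulVec_mul_vecMulVec,
      h2]
    ext1 p q
    simp only [Matrix.add_apply, Matrix.vecMulVec_apply, Pi.smul_apply, smul_eq_mul,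
      Matrix.smul_apply]
    ring

/-- The power `(-t)^m` of a Laurent polynomial ring. -/
noncomputable def negTPow (m : ℤ) : ℤ[T;T⁻¹] := C (m.negOnePow : ℤ) * T m

theorem negTPow_add (a b : ℤ) : negTPow (a + b) = negTPow a * negTPow b := by
  simp only [negTPow, Int.negOnePow_add, Units.val_mul, map_mul, T_add]; ring

theorem sum_Icc_neg_succ {M : Type*} [AddCommGroup M] (F : ℤ → M) (n : ℕ) :
    ∑ k ∈ Finset.Icc (-((n + 1 : ℕ) : ℤ)) ((n + 1 : ℕ) : ℤ), F k =
      ∑ k ∈ Finset.Icc (-(n : ℤ)) n, F k + F (n + 1) + F (-(n + 1)) := by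
  have : Finset.Icc (-((n + 1 : ℕ) : ℤ)) ((n + 1 : ℕ) : ℤ) =
      insert (n + 1 : ℤ) (insert (-(n + 1) : ℤ) (Finset.Icc (-(n : ℤ)) n)) := by
    ext x; simp only [Finset.mem_Icc, Finset.mem_insert]; push_cast; omega
  rw [this, Finset.sum_insert, Finset.sum_insert]
  · abel
  · simp
  · simp only [Finset.mem_insert, Finset.mem_Icc]; omega

theorem negTPow_natCast (n : ℕ) : negTPow n = (-T 1) ^ n := by
  induction n with
  | zero => simp [negTPow]
  | succ n ih =>
    rw [Nat.cast_succ, negTPow_add, ih, pow_succ]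
    simp [negTPow]

theorem negTPow_neg_natCast (n : ℕ) : negTPow (-n) = (-T (-1)) ^ n := by
  induction n with
  | zero => simp [negTPow]
  | succ n ih =>
    rw [Nat.cast_succ, neg_add, negTPow_add, ih, pow_succ]
    simp [negTPow]

theorem sum_negTPow (n : ℕ) :
    ∑ k ∈ Finset.Icc (-(n : ℤ)) n, negTPow k =
      altSum (T 1) n + altSum (T (-1)) n - 1 + (-T 1) ^ n + (-T (-1)) ^ n := by
  induction n with
  | zero => simp [altSum, negTPow]
  | succ n ih =>
    rw [sum_Icc_neg_succ, ih, altSum_succ, altSum_succ, ← negTPow_natCast, ← negTPow_natCast,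
      ← negTPow_neg_natCast, ← negTPow_neg_natCast]
    push_cast
    ring

/-- Multiplication by (-y)^n reverses the geometric sum: the exponents of -y become 1, …, n. -/
theorem altSum_mul_neg_pow {R : Type*} [CommRing R] {x y : R} (h : x * y = 1) (n : ℕ) :
    altSum x n * (-y) ^ n = altSum y n - 1 + (-y) ^ n := by
  induction n with
  | zero => simp [altSum]
  | succ n ih =>
    have h1 : (-x) ^ n * (-y) ^ n = 1 := by rw [← mul_pow, neg_mul_neg, h, one_pow]
    have h2 := altSum_succ y n
    rw [altSum_succ'] at h2
    rw [altSum_succ, altSum_succ]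
    linear_combination (-y) * ih + (-y) * h1 + h2

theorem sum_weighted_negTPow (n : ℕ) :
    ∑ k ∈ Finset.Icc (-(n : ℤ)) n, C (2 * ((n : ℤ) - |k|) + 1) * negTPow k =
      1 - T 1 * altSum (T 1) n - T (-1) * altSum (T (-1)) n +
        2 * altSum (T 1) n * altSum (T (-1)) n := by
  induction n with
  | zero => simp [altSum, negTPow]
  | succ n ih =>
    have h1 : ∀ k : ℤ, (C (2 * (((n + 1 : ℕ) : ℤ) - |k|) + 1) : ℤ[T;T⁻¹]) * negTPow k =
        C (2 * ((n : ℤ) - |k|) + 1) * negTPow k + 2 * negTPow k := by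
      intro k
      have : (2 : ℤ[T;T⁻¹]) = C 2 := by simp
      rw [this, ← add_mul, ← map_add]; push_cast; ring_nf
    rw [sum_Icc_neg_succ]
    simp only [h1, Finset.sum_add_distrib, ← Finset.mul_sum, ih, sum_negTPow]
    have e1 : |(n + 1 : ℤ)| = n + 1 := abs_of_nonneg (by positivity)
    have e2 : |(-(n + 1) : ℤ)| = n + 1 := by rw [abs_neg, e1]
    -- Passing from n to n+1 adds 2 to every weight; the new terms k = ±(n+1) get weight -1 + 2 = 1.
    have e3 : (C (2 * ((n : ℤ) - (n + 1)) + 1) : ℤ[T;T⁻¹]) = -1 := by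
      rw [show (2 * ((n : ℤ) - (n + 1)) + 1) = -1 by ring]; simp
    have e4 : negTPow (n + 1 : ℤ) = (-T 1) ^ (n + 1) := by rw [← negTPow_natCast]; push_cast; rfl
    have e5 : negTPow (-(n + 1) : ℤ) = (-T (-1)) ^ (n + 1) := by
      rw [← negTPow_neg_natCast]; push_cast; rfl
    have h2 := altSum_mul_neg_pow T_one_mul_T_neg_one n
    have h3 := altSum_mul_neg_pow T_neg_one_mul_T_one n
    have h4 : (-T 1 : ℤ[T;T⁻¹]) ^ n * (-T (-1)) ^ n = 1 := by
      rw [← mul_pow, neg_mul_neg, T_one_mul_T_neg_one, one_pow]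
    rw [e1, e2, e3, e4, e5, altSum_succ, altSum_succ, pow_succ, pow_succ]
    linear_combination (-2) * h2 - 2 * h3 - 2 * h4

theorem alexanderFormula_eq (n : ℕ) :
    alexanderFormula n = C ((n : ℤ).negOnePow : ℤ) *
      (1 - T 1 * altSum (T 1) n - T (-1) * altSum (T (-1)) n +
        2 * altSum (T 1) n * altSum (T (-1)) n) := by
  rw [← sum_weighted_negTPow, Finset.mul_sum, alexanderFormula]
  refine Finset.sum_congr rfl fun k _ => ?_
  simp only [Int.negOnePow_add, Units.val_mul, map_mul, negTPow]
  ring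

/-- Among the diagonal minors the middle one is t times `reducedDet`, and it is the one that comes
out symmetric under t ↔ t⁻¹, matching the formula with no further power of t. -/
theorem minor_minimalWord (n : ℕ) :
    ((burau (minimalWord n) - 1).submatrix (1 : Fin 3).succAbove (1 : Fin 3).succAbove).det =
      1 - T 1 * altSum (T 1) n - T (-1) * altSum (T (-1)) n +
        2 * altSum (T 1) n * altSum (T (-1)) n := by
  have h := T_one_mul_T_neg_one
  rw [minimalWord, burau_append, burau_append, burau_append, burau_replicate, burau_replicate,
    burau_singleton, burau_singleton, burauGen_eq, burauGen_eq, Matrix.det_fin_two]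
  simp only [if_true, Bool.false_eq_true, if_false]
  generalize altSum (T 1 : ℤ[T;T⁻¹]) n = c
  generalize altSum (T (-1) : ℤ[T;T⁻¹]) n = d
  have e0 : (1 : Fin 3).succAbove 0 = 0 := rfl
  have e1 : (1 : Fin 3).succAbove 1 = 2 := rfl
  have r0 : (burauRow 0 : Fin 3 → ℤ[T;T⁻¹]) = ![1, -1, 0] := by
    ext1 i; fin_cases i <;> simp [burauRow]
  have r1 : (burauRow 1 : Fin 3 → ℤ[T;T⁻¹]) = ![0, 1, -1] := by
    ext1 i; fin_cases i <;> simp [burauRow]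
  have c0 : (burauCol (0, false) : Fin 3 → ℤ[T;T⁻¹]) = ![-1, T (-1), 0] := by
    ext1 i; fin_cases i <;> simp [burauCol]
  have c1 : (burauCol (1, true) : Fin 3 → ℤ[T;T⁻¹]) = ![0, -T 1, 1] := by
    ext1 i; fin_cases i <;> simp [burauCol]
  rw [r0, r1, c0, c1]
  generalize (T 1 : ℤ[T;T⁻¹]) = t at *
  generalize (T (-1) : ℤ[T;T⁻¹]) = t' at *
  simp only [Matrix.submatrix_apply, e0, e1, Matrix.sub_apply, Matrix.mul_apply,
    Matrix.add_apply, Matrix.smul_apply, Matrix.vecMulVec_apply,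
    Matrix.one_apply, smul_eq_mul]
  simp [Fin.sum_univ_succ]
  linear_combination 2 * c * d * h

theorem associated_reducedDet_minimalWord (n : ℕ) :
    Associated (reducedDet (minimalWord n)) (alexanderFormula n) := by
  have hu : IsUnit (C ((n : ℤ).negOnePow : ℤ) : ℤ[T;T⁻¹]) := ((n : ℤ).negOnePow.isUnit).map C
  rw [alexanderFormula_eq, ← minor_minimalWord]
  exact (associated_minor _ 1 1).symm.trans (associated_unit_mul_left _ _ hu).symm

/-! ### Minimality -/

/-- The Laurent polynomial `f` has only monomials of exponents between `a` and `b`. -/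
def SupportedIn (a b : ℤ) (f : ℤ[T;T⁻¹]) : Prop := ∀ m, f.coeff m ≠ 0 → a ≤ m ∧ m ≤ b

theorem coeff_T_mul (r m : ℤ) (f : ℤ[T;T⁻¹]) : (T r * f).coeff m = f.coeff (m - r) := by
  rw [T, AddMonoidAlgebra.coeff_single_mul_apply, one_mul, neg_add_eq_sub]

theorem coeff_C_mul (c m : ℤ) (f : ℤ[T;T⁻¹]) : (C c * f).coeff m = c * f.coeff m := by
  rw [← single_eq_C, AddMonoidAlgebra.coeff_single_mul_apply, neg_zero, zero_add]

theorem SupportedIn.add {a b : ℤ} {f g : ℤ[T;T⁻¹]} (hf : SupportedIn a b f)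
    (hg : SupportedIn a b g) : SupportedIn a b (f + g) := by
  intro m hm
  by_cases h : f.coeff m = 0
  · refine hg m fun h2 => hm ?_
    rw [AddMonoidAlgebra.coeff_add, Finsupp.add_apply, h, h2, add_zero]
  · exact hf m h

theorem SupportedIn.mono {a b a' b' : ℤ} {f : ℤ[T;T⁻¹]} (hf : SupportedIn a b f)
    (h1 : a' ≤ a) (h2 : b ≤ b') : SupportedIn a' b' f :=
  fun m hm => ⟨h1.trans (hf m hm).1, (hf m hm).2.trans h2⟩

theorem SupportedIn.neg {a b : ℤ} {f : ℤ[T;T⁻¹]} (hf : SupportedIn a b f) :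
    SupportedIn a b (-f) := by
  intro m hm
  refine hf m fun h => hm ?_
  rw [AddMonoidAlgebra.coeff_neg, Finsupp.neg_apply, h, neg_zero]

theorem SupportedIn.T_mul {a b : ℤ} {f : ℤ[T;T⁻¹]} (hf : SupportedIn a b f) (r : ℤ) :
    SupportedIn (a + r) (b + r) (T r * f) := by
  intro m hm
  rw [coeff_T_mul] at hm
  have := hf _ hm
  omega

theorem supportedIn_C (c : ℤ) : SupportedIn 0 0 (C c) := by
  intro m hm
  rw [C_apply] at hm
  split_ifs at hm with h
  · omega
  · exact absurd rfl hm

/-- The determinant is affine along a rank-one direction: after bordering the matrix, the scalar `s`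
occurs in one row only. -/
theorem det_add_smul_vecMulVec {R m : Type*} [CommRing R] [Fintype m] [DecidableEq m]
    (N : Matrix m m R) (a b : m → R) (s : R) :
    (N + s • Matrix.vecMulVec a b).det =
      (1 - s) * N.det + s * (N + Matrix.vecMulVec a b).det := by
  have h : ∀ r : R, (N + r • Matrix.vecMulVec a b).det =
      ((Matrix.fromBlocks N (Matrix.replicateCol Unit a) 0 0).updateRow (Sum.inr ())
        (Sum.elim (-(r • b)) 1)).det := by
    intro r
    have : (Matrix.fromBlocks N (Matrix.replicateCol Unit a) 0 0).updateRow (Sum.inr ())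
        (Sum.elim (-(r • b)) 1) = Matrix.fromBlocks N (Matrix.replicateCol Unit a)
          (Matrix.replicateRow Unit (-(r • b))) 1 := by
      ext1 i j
      rcases i with i | ⟨⟩ <;> rcases j with j | ⟨⟩ <;> simp
    rw [this, Matrix.det_fromBlocks_one₂₂]
    congr 1
    ext1 i j
    simp [Matrix.vecMulVec_apply, Matrix.mul_apply]
    ring
  have h2 : (Sum.elim (-(s • b)) 1 : m ⊕ Unit → R) =
      (1 - s) • Sum.elim (-((0 : R) • b)) 1 + s • Sum.elim (-((1 : R) • b)) 1 := by
    ext1 j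
    rcases j with j | ⟨⟩ <;> simp
  have h0 := h 0
  have h1 := h 1
  rw [zero_smul, add_zero] at h0
  rw [one_smul] at h1
  rw [h, h2, Matrix.det_updateRow_add, Matrix.det_updateRow_smul, Matrix.det_updateRow_smul,
    h0, h1]

/-- Affinity in T s splits off one letter. The two values that remain, at 0 and 1 in place of T s,
have integer coefficients, so they are absorbed into `Y` and the hypothesis for the shorter word
applies. -/
theorem supportedIn_det_aux {k : ℕ} (M : Matrix (Fin (k + 1)) (Fin (k + 1)) ℤ[T;T⁻¹])
    (X Y : Matrix (Fin (k + 1)) (Fin (k + 1)) ℤ) (p q r : Fin (k + 1) → ℤ) (s : ℤ) {a b : ℤ}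
    (h : ∀ Y' : Matrix (Fin (k + 1)) (Fin (k + 1)) ℤ,
      SupportedIn a b (X.map C + Y'.map C * M).det) :
    ∃ f g : ℤ[T;T⁻¹], SupportedIn a b f ∧ SupportedIn a b g ∧
      (X.map C + Y.map C * ((1 + Matrix.vecMulVec ((fun i => (C (p i) : ℤ[T;T⁻¹])) + (T s : ℤ[T;T⁻¹]) • fun i => C (q i))
        (fun i => (C (r i) : ℤ[T;T⁻¹]))) * M)).det = (1 - T s) * f + T s * g := by
  refine ⟨_, _, h (Y * (1 + Matrix.vecMulVec p r)), h (Y * (1 + Matrix.vecMulVec (p + q) r)), ?_⟩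
  have e : ∀ p : Fin (k + 1) → ℤ, (Y * (1 + Matrix.vecMulVec p r)).map (C : ℤ →+* ℤ[T;T⁻¹]) * M =
      Y.map C * M + Matrix.vecMulVec (Y.map C *ᵥ fun i => C (p i))
        ((fun i => C (r i)) ᵥ* M) := by
    intro p
    have : (Matrix.vecMulVec p r).map (C : ℤ →+* ℤ[T;T⁻¹]) =
        Matrix.vecMulVec (fun i => C (p i)) (fun i => C (r i)) := by
      ext1 i j; simp [Matrix.vecMulVec_apply]
    rw [mul_add, mul_one, Matrix.map_add _ (map_add C), Matrix.map_mul, this, add_mul,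
      Matrix.mul_vecMulVec, Matrix.vecMulVec_mul]
  have e2 : (fun i => (C ((p + q) i) : ℤ[T;T⁻¹])) = (fun i => C (p i)) + fun i => C (q i) := by
    ext1 i; simp
  rw [e, e, e2, Matrix.mulVec_add]
  simp only [Matrix.add_vecMulVec, add_mul, one_mul, mul_add, Matrix.vecMulVec_mul,
    Matrix.mul_vecMulVec, Matrix.smul_vecMulVec, Matrix.smul_mul, Matrix.mul_smul, ← add_assoc]
  rw [det_add_smul_vecMulVec]

/-- The arbitrary integer matrix `Y` makes the induction on the word possible. A positive letter
extends the upper end of the exponent range by one, a negative letter the lower end. -/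
theorem supportedIn_det {k : ℕ} (w : BraidWord k)
    (X Y : Matrix (Fin (k + 1)) (Fin (k + 1)) ℤ) :
    SupportedIn (-((w.countP fun x => !x.2 : ℕ) : ℤ)) ((w.countP fun x => x.2 : ℕ) : ℤ)
      (X.map C + Y.map C * burau w).det := by
  induction w generalizing Y with
  | nil =>
    have : X.map (C : ℤ →+* ℤ[T;T⁻¹]) + Y.map C * burau ([] : BraidWord k) =
        C.mapMatrix (X + Y) := by
      ext1 i j; simp [burau]
    rw [this, ← RingHom.map_det]
    exact supportedIn_C _
  | cons x w ih =>
    rcases x with ⟨i, e⟩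
    have hr : (burauRow i : Fin (k + 1) → ℤ[T;T⁻¹]) = fun j => C
        ((Pi.single i.castSucc 1 - Pi.single i.succ 1 : Fin (k + 1) → ℤ) j) := by
      ext1 j
      simp only [burauRow, Pi.sub_apply, Pi.single_apply, map_sub]
      split_ifs <;> simp
    rw [burau_cons, burauGen_eq, hr]
    cases e
    · have hc : (burauCol (i, false) : Fin (k + 1) → ℤ[T;T⁻¹]) =
          (fun j => (C : ℤ →+* ℤ[T;T⁻¹]) ((-Pi.single i.castSucc 1 : Fin (k + 1) → ℤ) j)) +
            (T (-1) : ℤ[T;T⁻¹]) • fun j => (C : ℤ →+* ℤ[T;T⁻¹]) ((Pi.single i.succ 1 : Fin (k + 1) → ℤ) j) := by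
        ext1 j
        simp only [burauCol, Pi.add_apply, Pi.smul_apply, Pi.neg_apply, Pi.single_apply,
          smul_eq_mul, Bool.false_eq_true, if_false, map_neg]
        split_ifs <;> simp
      obtain ⟨f, g, hf, hg, h⟩ := supportedIn_det_aux (burau w) X Y _ _
        (Pi.single i.castSucc 1 - Pi.single i.succ 1) (-1) (fun Y' => ih Y')
      rw [hc, h]
      have e1 : (1 - T (-1)) * f + T (-1) * g = f + -(T (-1) * f) + T (-1) * g := by ring
      rw [e1]
      simp only [List.countP_cons, Bool.not_false, if_true, Bool.false_eq_true, if_false, add_zero]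
      push_cast
      exact ((hf.mono (by omega) le_rfl).add ((hf.T_mul (-1)).neg.mono (by omega) (by omega))).add
        ((hg.T_mul (-1)).mono (by omega) (by omega))
    · have hc : (burauCol (i, true) : Fin (k + 1) → ℤ[T;T⁻¹]) =
          (fun j => (C : ℤ →+* ℤ[T;T⁻¹]) ((Pi.single i.succ 1 : Fin (k + 1) → ℤ) j)) +
            (T 1 : ℤ[T;T⁻¹]) • fun j => (C : ℤ →+* ℤ[T;T⁻¹]) ((-Pi.single i.castSucc 1 : Fin (k + 1) → ℤ) j) := by
        ext1 j
        simp only [burauCol, Pi.add_apply, Pi.smul_apply, Pi.neg_apply, Pi.single_apply,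
          smul_eq_mul, if_true, map_neg]
        split_ifs <;> simp [add_comm]
      obtain ⟨f, g, hf, hg, h⟩ := supportedIn_det_aux (burau w) X Y _ _
        (Pi.single i.castSucc 1 - Pi.single i.succ 1) 1 (fun Y' => ih Y')
      rw [hc, h]
      have e1 : (1 - T 1) * f + T 1 * g = f + -(T 1 * f) + T 1 * g := by ring
      rw [e1]
      simp only [List.countP_cons, Bool.not_true, if_true, Bool.false_eq_true, if_false, add_zero]
      push_cast
      exact ((hf.mono le_rfl (by omega)).add ((hf.T_mul 1).neg.mono (by omega) (by omega))).add
        ((hg.T_mul 1).mono (by omega) (by omega))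

theorem supportedIn_T_mul_reducedDet {k : ℕ} (w : BraidWord k) (i : Fin (k + 1)) :
    SupportedIn (-((w.countP fun x => !x.2 : ℕ) : ℤ)) ((w.countP fun x => x.2 : ℕ) : ℤ)
      (T (i : ℕ) * reducedDet w) := by
  have h := congrFun (congrFun (adjugate_burau_sub_one w) i) i
  rw [Matrix.adjugate_apply, Matrix.smul_apply, Matrix.vecMulVec_apply] at h
  simp only [Pi.one_apply, one_mul, smul_eq_mul, powVec] at h
  rw [mul_comm, ← h]
  -- This choice of X and Y gives `burau w - 1` with row i replaced by the i-th unit vector, whose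
  -- determinant is the i-th diagonal entry of the adjugate.
  convert supportedIn_det w (Matrix.diagonal fun j => if j = i then 1 else -1)
    (Matrix.diagonal fun j => if j = i then 0 else 1) using 2
  ext1 a b
  rw [Matrix.diagonal_map (map_zero C), Matrix.diagonal_map (map_zero C), Matrix.add_apply,
    Matrix.diagonal_mul, Matrix.updateRow_apply, Matrix.diagonal_apply, Matrix.sub_apply,
    Matrix.one_apply, Pi.single_apply]
  rcases eq_or_ne a i with rfl | ha
  · simp [eq_comm]
  · simp only [ha, if_false]
    split_ifs <;> simp; ring

theorem countP_add_countP_not {α : Type*} (p : α → Bool) (l : List α) :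
    (l.countP fun x => !p x) + l.countP p = l.length := by
  rw [List.length_eq_countP_add_countP p, add_comm]
  congr 2
  ext1 x
  simp

/-- If u or its inverse had two terms, two different pairs of exponents would have uniquely attained
sums, giving nonzero coefficients of the product. Both sums would be 0, the only exponent of 1,
against uniqueness. -/
theorem exists_of_isUnit_laurent {u : ℤ[T;T⁻¹]} (hu : IsUnit u) :
    ∃ (r : ℤ) (m : ℤ), IsUnit r ∧ u = C r * T m := by
  obtain ⟨v, huv⟩ := hu.exists_right_inv
  have hu0 : u ≠ 0 := hu.ne_zero
  have hv0 : v ≠ 0 := by rintro rfl; simp at huv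
  have hcoef : ∀ m : ℤ, (u * v).coeff m ≠ 0 → m = 0 := by
    intro m hm
    by_contra h
    rw [huv, ← map_one C, C_apply, if_neg h] at hm
    exact hm rfl
  have hcard : ¬ 1 < u.coeff.support.card * v.coeff.support.card := by
    intro hc
    obtain ⟨p, hp, q, hq, hpq, h1, h2⟩ := TwoUniqueSums.uniqueAdd_of_one_lt_card hc
    rw [Finset.mem_product, Finsupp.mem_support_iff, Finsupp.mem_support_iff] at hp hq
    have e1 := hcoef (p.1 + p.2) (by
      rw [AddMonoidAlgebra.coeff_mul_add_of_uniqueAdd h1]; exact mul_ne_zero hp.1 hp.2)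
    have e2 := hcoef (q.1 + q.2) (by
      rw [AddMonoidAlgebra.coeff_mul_add_of_uniqueAdd h2]; exact mul_ne_zero hq.1 hq.2)
    have := h1 (Finsupp.mem_support_iff.2 hq.1) (Finsupp.mem_support_iff.2 hq.2) (by rw [e1, e2])
    exact hpq (Prod.ext this.1.symm this.2.symm)
  have hsu : 0 < u.coeff.support.card := by
    rw [Finset.card_pos, Finsupp.support_nonempty_iff]
    exact fun h => hu0 (AddMonoidAlgebra.coeff_eq_zero.1 h)
  have hsv : 0 < v.coeff.support.card := by
    rw [Finset.card_pos, Finsupp.support_nonempty_iff]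
    exact fun h => hv0 (AddMonoidAlgebra.coeff_eq_zero.1 h)
  have h1 : u.coeff.support.card = 1 := by nlinarith
  obtain ⟨m, r, hr, h⟩ := Finsupp.card_support_eq_one'.1 h1
  have hu' : u = C r * T m := by
    rw [← single_eq_C_mul_T]
    exact AddMonoidAlgebra.coeff_injective h
  refine ⟨r, m, ?_, hu'⟩
  have h0 : (u * v).coeff 0 = 1 := by rw [huv, ← map_one C, C_apply, if_pos rfl]
  rw [hu', mul_assoc, coeff_C_mul] at h0
  exact IsUnit.of_mul_eq_one _ h0

/-! ### Extreme coefficients of the formula and bounds on braid words -/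

theorem coeff_alexanderFormula (n : ℕ) (m : ℤ) :
    (alexanderFormula n).coeff m = if m ∈ Finset.Icc (-(n : ℤ)) n then
      ((n + m).negOnePow : ℤ) * (2 * ((n : ℤ) - |m|) + 1) else 0 := by
  rw [alexanderFormula, AddMonoidAlgebra.coeff_sum, Finsupp.finsetSum_apply]
  simp only [coeff_C_mul, T_apply, mul_ite, mul_one, mul_zero]
  rw [Finset.sum_ite_eq']

theorem coeff_alexanderFormula_self (n : ℕ) : (alexanderFormula n).coeff n = 1 := by
  rw [coeff_alexanderFormula, if_pos (by simp), Int.negOnePow_even _ ⟨_, rfl⟩]; simp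

theorem coeff_alexanderFormula_neg (n : ℕ) : (alexanderFormula n).coeff (-n) = 1 := by
  rw [coeff_alexanderFormula, if_pos (by simp)]; simp

theorem coeff_alexanderFormula_succ (n : ℕ) : (alexanderFormula n).coeff (n + 1) = 0 := by
  rw [coeff_alexanderFormula, if_neg (by simp)]

theorem coeff_alexanderFormula_pred {n : ℕ} (hn : 1 ≤ n) :
    (alexanderFormula n).coeff (n - 1) = -3 := by
  rw [coeff_alexanderFormula, if_pos (by simp; omega), Int.negOnePow_odd _ ⟨n - 1, by ring⟩,
    abs_of_nonneg (by omega)]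
  push_cast; ring

/-- A braid word whose reduced determinant is the formula has many letters. -/
theorem le_length_of_associated {k : ℕ} (w : BraidWord k) (n : ℕ)
    (h : Associated (reducedDet w) (alexanderFormula n)) : 2 * n + k ≤ w.length := by
  obtain ⟨u, hu⟩ := h
  obtain ⟨r, m, -, hr⟩ := exists_of_isUnit_laurent u.isUnit
  rw [hr] at hu
  have hc : ∀ j, (alexanderFormula n).coeff j ≠ 0 → (reducedDet w).coeff (j - m) ≠ 0 := by
    intro j hj h0
    rw [← hu, mul_comm, mul_assoc, coeff_C_mul, coeff_T_mul, h0, mul_zero] at hj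
    exact hj rfl
  have h1 := hc (-n) (by rw [coeff_alexanderFormula_neg]; exact one_ne_zero)
  have h2 := hc n (by rw [coeff_alexanderFormula_self]; exact one_ne_zero)
  -- The bottom exponent is bounded with i = 0 and the top one with i = k; this difference supplies
  -- the extra k letters in the bound.
  have h3 := supportedIn_T_mul_reducedDet w 0 (-n - m) (by
    rw [coeff_T_mul]; simpa using h1)
  have h4 := supportedIn_T_mul_reducedDet w (Fin.last k) (n - m + k) (by
    rw [coeff_T_mul]; simpa using h2)
  have h5 := countP_add_countP_not (fun x : Fin k × Bool => x.2) w
  omega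

/-- For 2 × 2 matrices the adjugate determines the matrix, so all of `burau w` is expressed by
`reducedDet w`. -/
theorem det_burau_two_strands (w : BraidWord 1) :
    (burau w).det = 1 + (reducedDet w + T 1 * reducedDet w) := by
  have h := adjugate_burau_sub_one w
  rw [Matrix.adjugate_fin_two] at h
  have h00 := congrFun (congrFun h 0) 0
  have h01 := congrFun (congrFun h 0) 1
  have h10 := congrFun (congrFun h 1) 0
  have h11 := congrFun (congrFun h 1) 1
  simp [powVec] at h00 h01 h10 h11
  rw [Matrix.det_fin_two]
  have e1 : burau w 0 1 = -(reducedDet w * T 1) := by rw [← h01, neg_neg]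
  have e2 : burau w 1 0 = -reducedDet w := by rw [← h10, neg_neg]
  rw [e1, e2, eq_add_of_sub_eq h00, eq_add_of_sub_eq h11]
  ring

/-- By the determinant identity, (1+t)·`reducedDet w` has the form ±t^q - 1. The top coefficients 1,
-3 of the formula would give it the adjacent coefficients ±1 and ±2; a coefficient ±2 requires both
monomials to have exponent 0, leaving nothing for the ±1. -/
theorem not_associated_two_strands (w : BraidWord 1) {n : ℕ} (hn : 1 ≤ n) :
    ¬ Associated (reducedDet w) (alexanderFormula n) := by
  rintro ⟨u, hu⟩
  obtain ⟨r, m, -, hr⟩ := exists_of_isUnit_laurent u.isUnit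
  rw [hr] at hu
  obtain ⟨ε, q, hε, hd⟩ := exists_of_isUnit_laurent
    ((Matrix.isUnit_iff_isUnit_det _).1 (isUnit_burau w))
  rw [det_burau_two_strands] at hd
  have hc : ∀ j, (alexanderFormula n).coeff j = r * (reducedDet w).coeff (j - m) := by
    intro j
    rw [← hu, mul_comm, mul_assoc, coeff_C_mul, coeff_T_mul]
  have he : ∀ j, (reducedDet w).coeff j + (reducedDet w).coeff (j - 1) =
      (if q = j then ε else 0) - if j = 0 then 1 else 0 := by
    intro j
    have := congrArg (fun f : ℤ[T;T⁻¹] => f.coeff j) hd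
    simp only [AddMonoidAlgebra.coeff_add, Finsupp.add_apply, coeff_T_mul, coeff_C_mul,
      T_apply, ← map_one C, C_apply, mul_ite, mul_one, mul_zero] at this
    rw [← this]; ring
  have h1 := hc (n + 1)
  have h2 := hc n
  have h3 := hc (n - 1)
  have h4 := he (n + 1 - m)
  have h5 := he (n - m)
  rw [coeff_alexanderFormula_succ] at h1
  rw [coeff_alexanderFormula_self] at h2
  rw [coeff_alexanderFormula_pred hn] at h3
  rw [show (n + 1 - m - 1 : ℤ) = n - m by ring] at h4
  rw [show (n - m - 1 : ℤ) = n - 1 - m by ring] at h5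
  have hr0 : r = 1 ∨ r = -1 := Int.isUnit_iff.1 (IsUnit.of_mul_eq_one _ h2.symm)
  rw [Int.isUnit_iff] at hε
  rcases hr0 with rfl | rfl <;> rcases hε with rfl | rfl <;> split_ifs at h4 h5 <;> omega

/-! ### Closures of braids -/

/-- The braid of a single letter. -/
def letterBraid {k : ℕ} (x : Fin k × Bool) : BraidGroup k :=
  if x.2 then PresentedGroup.of x.1 else (PresentedGroup.of x.1)⁻¹

theorem toBraid_eq_prod {k : ℕ} (w : BraidWord k) : w.toBraid = (w.map letterBraid).prod := by
  have : FreeGroup.mk w = (w.map fun x => cond x.2 (FreeGroup.of x.1) (FreeGroup.of x.1)⁻¹).prod := by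
    rw [← FreeGroup.lift_mk, FreeGroup.lift_of_eq_id]; rfl
  rw [BraidWord.toBraid, this, map_list_prod, List.map_map]
  congr 2
  ext1 ⟨i, e⟩
  cases e <;> rfl

theorem toBraid_append {k : ℕ} (u v : BraidWord k) :
    BraidWord.toBraid (u ++ v) = u.toBraid * v.toBraid := by
  simp [toBraid_eq_prod]

theorem toBraid_surjective (k : ℕ) : Function.Surjective (BraidWord.toBraid (k := k)) := by
  intro x
  obtain ⟨g, rfl⟩ := PresentedGroup.mk_surjective _ x
  exact ⟨g.toWord, by rw [BraidWord.toBraid, FreeGroup.mk_toWord]⟩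

/-- The link type of the closure of a braid. -/
noncomputable def closureOf {k : ℕ} (x : BraidGroup k) : LinkType :=
  (Function.surjInv (toBraid_surjective k) x).closure

theorem closureOf_toBraid {k : ℕ} (w : BraidWord k) : closureOf w.toBraid = w.closure :=
  Quot.sound (MarkovMove.braid _ _ (Function.surjInv_eq (toBraid_surjective k) _))

theorem closureOf_mul_comm {k : ℕ} (x y : BraidGroup k) : closureOf (x * y) = closureOf (y * x) := by
  obtain ⟨u, rfl⟩ := toBraid_surjective k x
  obtain ⟨v, rfl⟩ := toBraid_surjective k y
  rw [← toBraid_append, ← toBraid_append, closureOf_toBraid, closureOf_toBraid]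
  exact Quot.sound (MarkovMove.conj u v)

theorem closureOf_conj {k : ℕ} (x g : BraidGroup k) : closureOf (g * x * g⁻¹) = closureOf x := by
  rw [closureOf_mul_comm, inv_mul_cancel_left]

/-! ### The standard generators -/

/-- The generator with index `i`, counted from `0`; trivial if there is no such generator. -/
def sigma (k i : ℕ) : BraidGroup k := if h : i < k then PresentedGroup.of ⟨i, h⟩ else 1

theorem sigma_of_lt {k i : ℕ} (h : i < k) : sigma k i = PresentedGroup.of ⟨i, h⟩ := dif_pos h

theorem sigma_commute {k i j : ℕ} (h : i + 1 < j) : Commute (sigma k i) (sigma k j) := by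
  by_cases hj : j < k
  · have hi : i < k := by omega
    rw [sigma_of_lt hi, sigma_of_lt hj]
    refine PresentedGroup.mk_eq_mk_of_mul_inv_mem (x := FreeGroup.of _ * FreeGroup.of _)
      (y := FreeGroup.of _ * FreeGroup.of _) (Or.inl ⟨_, _, h, rfl⟩)
  · rw [sigma, sigma, dif_neg hj]
    exact Commute.one_right _

/-- Unlike commutation, this needs both indices in range: it fails if σ_{i+1} is replaced by the
default value 1. -/
theorem sigma_braid {k i : ℕ} (h : i + 1 < k) :
    sigma k i * sigma k (i + 1) * sigma k i = sigma k (i + 1) * sigma k i * sigma k (i + 1) := by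
  have hi : i < k := by omega
  rw [sigma_of_lt hi, sigma_of_lt h]
  exact PresentedGroup.mk_eq_mk_of_mul_inv_mem
    (x := FreeGroup.of _ * FreeGroup.of _ * FreeGroup.of _)
    (y := FreeGroup.of _ * FreeGroup.of _ * FreeGroup.of _) (Or.inr ⟨_, _, rfl, rfl⟩)

theorem letterBraid_eq {k : ℕ} (x : Fin k × Bool) :
    letterBraid x = if x.2 then sigma k x.1 else (sigma k x.1)⁻¹ := by
  rw [sigma_of_lt x.1.isLt]; rfl

/-- Adding a strand on the right. -/
def shiftRight (k : ℕ) : BraidGroup k →* BraidGroup (k + 1) :=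
  PresentedGroup.toGroup (rels := braidRels k) (f := fun i : Fin k => sigma (k + 1) i) (by
    rintro _ (⟨i, j, hij, rfl⟩ | ⟨i, j, hij, rfl⟩)
    · simp [(sigma_commute hij).eq]
    · have := sigma_braid (k := k + 1) (i := i) (by omega)
      simp [← hij, this])

/-- Adding a strand on the left. -/
def shiftLeft (k : ℕ) : BraidGroup k →* BraidGroup (k + 1) :=
  PresentedGroup.toGroup (rels := braidRels k) (f := fun i : Fin k => sigma (k + 1) (i + 1)) (by
    rintro _ (⟨i, j, hij, rfl⟩ | ⟨i, j, hij, rfl⟩)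
    · have := sigma_commute (k := k + 1) (i := i + 1) (j := j + 1) (by omega)
      simp [this.eq]
    · have := sigma_braid (k := k + 1) (i := i + 1) (by omega)
      simp [← hij, this])

theorem shiftRight_sigma {k i : ℕ} (h : i < k) : shiftRight k (sigma k i) = sigma (k + 1) i := by
  rw [sigma_of_lt h]; exact PresentedGroup.toGroup.of _

theorem shiftLeft_sigma {k i : ℕ} (h : i < k) :
    shiftLeft k (sigma k i) = sigma (k + 1) (i + 1) := by
  rw [sigma_of_lt h]; exact PresentedGroup.toGroup.of _

theorem toBraid_addRight {k : ℕ} (w : BraidWord k) : w.addRight.toBraid = shiftRight k w.toBraid := by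
  rw [toBraid_eq_prod, toBraid_eq_prod, map_list_prod, BraidWord.addRight, List.map_map,
    List.map_map]
  congr 2
  ext1 x
  simp only [Function.comp_apply, letterBraid_eq, apply_ite (shiftRight k), map_inv,
    shiftRight_sigma x.1.isLt, Fin.val_castSucc]

theorem toBraid_addLeft {k : ℕ} (w : BraidWord k) : w.addLeft.toBraid = shiftLeft k w.toBraid := by
  rw [toBraid_eq_prod, toBraid_eq_prod, map_list_prod, BraidWord.addLeft, List.map_map,
    List.map_map]
  congr 2
  ext1 x
  simp only [Function.comp_apply, letterBraid_eq, apply_ite (shiftLeft k), map_inv,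
    shiftLeft_sigma x.1.isLt, Fin.val_succ]

/-- Only the positive sign is needed here, and only the negative one in `closureOf_destabFirst`:
these are the signs at the two ends of the lemniscate braid. -/
theorem closureOf_destabLast {k : ℕ} (x y : BraidGroup k) :
    closureOf (shiftRight k x * sigma (k + 1) k * shiftRight k y) = closureOf (x * y) := by
  obtain ⟨u, rfl⟩ := toBraid_surjective k x
  obtain ⟨v, rfl⟩ := toBraid_surjective k y
  have h : sigma (k + 1) k = BraidWord.toBraid [(Fin.last k, true)] := by
    simp [toBraid_eq_prod, letterBraid_eq]
  rw [← toBraid_append, ← toBraid_addRight, ← toBraid_addRight, h, ← toBraid_append,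
    ← toBraid_append, closureOf_toBraid, closureOf_toBraid]
  exact Quot.sound (MarkovMove.destabLast u v true)

theorem closureOf_destabFirst {k : ℕ} (x y : BraidGroup k) :
    closureOf (shiftLeft k x * (sigma (k + 1) 0)⁻¹ * shiftLeft k y) = closureOf (x * y) := by
  obtain ⟨u, rfl⟩ := toBraid_surjective k x
  obtain ⟨v, rfl⟩ := toBraid_surjective k y
  have h : (sigma (k + 1) 0)⁻¹ = BraidWord.toBraid [((0 : Fin (k + 1)), false)] := by
    simp [toBraid_eq_prod, letterBraid_eq]
  rw [← toBraid_append, ← toBraid_addLeft, ← toBraid_addLeft, h, ← toBraid_append,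
    ← toBraid_append, closureOf_toBraid, closureOf_toBraid]
  exact Quot.sound (MarkovMove.destabFirst u v false)

/-! ### Products of consecutive generators -/

section Consecutive

variable {G : Type*} [Group G] (s : ℕ → G)

/-- The product `s p * s (p + 1) * ⋯ * s (p + m - 1)`. -/
def consec (p m : ℕ) : G := ((List.range m).map fun i => s (p + i)).prod

theorem consec_zero (p : ℕ) : consec s p 0 = 1 := rfl

theorem consec_succ (p m : ℕ) : consec s p (m + 1) = consec s p m * s (p + m) := by
  simp [consec, List.range_succ]

theorem consec_one (p : ℕ) : consec s p 1 = s p := by simp [consec]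

theorem consec_add (p a b : ℕ) : consec s p (a + b) = consec s p a * consec s (p + a) b := by
  simp only [consec, List.range_add, List.map_append, List.prod_append, List.map_map]
  congr 2
  refine List.map_congr_left fun i _ => ?_
  simp only [Function.comp_apply, add_assoc]

theorem consec_succ' (p m : ℕ) : consec s p (m + 1) = s p * consec s (p + 1) m := by
  simp only [consec, List.range_succ_eq_map, List.map_cons, List.prod_cons, List.map_map, add_zero]
  congr 2
  refine List.map_congr_left fun i _ => ?_
  simp only [Function.comp_apply]
  congr 1; omega

variable {s}

theorem commute_consec {x : G} {p m : ℕ} (h : ∀ i < m, Commute x (s (p + i))) :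
    Commute x (consec s p m) := by
  induction m with
  | zero => rw [consec_zero]; exact Commute.one_right _
  | succ m ih =>
    rw [consec_succ]
    exact (ih fun i hi => h i (by omega)).mul_right (h m (by omega))

theorem map_consec {H : Type*} [Group H] (f : G →* H) (p m : ℕ) :
    f (consec s p m) = consec (fun i => f (s i)) p m := by
  simp only [consec, map_list_prod, List.map_map]; rfl

theorem consec_congr {s' : ℕ → G} {p p' m : ℕ} (h : ∀ i < m, s (p + i) = s' (p' + i)) :
    consec s p m = consec s' p' m := by
  simp only [consec]
  congr 1
  exact List.map_congr_left fun i hi => h i (List.mem_range.1 hi)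

/-- A generator passes through a run of consecutive generators with its index lowered by one: one
braid relation does it, all other factors commute. -/
theorem slide (hc : ∀ i j, i + 1 < j → Commute (s i) (s j)) {p m j : ℕ} (hj : j < m)
    (hb : ∀ i < m, s (p + i) * s (p + i + 1) * s (p + i) =
      s (p + i + 1) * s (p + i) * s (p + i + 1)) :
    s (p + j + 1) * consec s p (m + 1) = consec s p (m + 1) * s (p + j) := by
  induction m with
  | zero => omega
  | succ m ih =>
    rcases Nat.lt_succ_iff_lt_or_eq.1 hj with hj | rfl
    · have h1 := ih hj fun i hi => hb i (by omega)
      have h2 := hc (p + j) (p + (m + 1)) (by omega)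
      rw [consec_succ, ← mul_assoc, h1, mul_assoc, h2.eq, mul_assoc]
    · have h1 : Commute (s (p + j + 1)) (consec s p j) :=
        commute_consec fun i hi => (hc _ _ (by omega)).symm
      have h2 := hb j (by omega)
      rw [consec_succ, consec_succ, ← mul_assoc, ← mul_assoc, h1.eq]
      rw [mul_assoc, mul_assoc, ← mul_assoc (s (p + j + 1)), mul_assoc (consec s p j),
        mul_assoc (consec s p j)]
      exact congrArg (consec s p j * ·) h2.symm

theorem consec_mul_consec (hc : ∀ i j, i + 1 < j → Commute (s i) (s j)) {p m : ℕ} (j : ℕ) (hj : j ≤ m)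
    (hb : ∀ i < m, s (p + i) * s (p + i + 1) * s (p + i) =
      s (p + i + 1) * s (p + i) * s (p + i + 1)) :
    consec s (p + 1) j * consec s p (m + 1) = consec s p (m + 1) * consec s p j := by
  induction j with
  | zero => simp [consec_zero]
  | succ j ih =>
    have h := slide hc (p := p) (m := m) (j := j) (by omega) hb
    rw [consec_succ, consec_succ s p j, mul_assoc, add_right_comm, h, ← mul_assoc, ih (by omega),
      mul_assoc]

/-- A product of generators of a group in which generators with non-adjacent indices commute is
conjugate to the product with the even ones first. -/
theorem exists_conj_even_odd (hc : ∀ i j, i + 1 < j → Commute (s i) (s j)) (m : ℕ) :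
    ∃ g ∈ Subgroup.closure {x | ∃ i, i + 1 < m ∧ x = s i},
      (((List.range m).filter (fun i => i % 2 = 0)).map s).prod *
        (((List.range m).filter (fun i => i % 2 = 1)).map s).prod = g * consec s 0 m * g⁻¹ := by
  induction m with
  | zero => exact ⟨1, one_mem _, by simp [consec_zero]⟩
  | succ m ih =>
    obtain ⟨g, hg, h⟩ := ih
    -- This is why the statement records where g lies: it involves only generators at distance at
    -- least two from s m.
    have hcg : Commute (s m) g := by
      refine Subgroup.closure_induction (p := fun x _ => Commute (s m) x) ?_ (Commute.one_right _)
        (fun _ _ _ _ h1 h2 => h1.mul_right h2) (fun _ _ h => h.inv_right) hg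
      rintro _ ⟨i, hi, rfl⟩
      exact (hc i m hi).symm
    have hg' : g ∈ Subgroup.closure {x | ∃ i, i + 1 < m + 1 ∧ x = s i} := by
      refine Subgroup.closure_mono ?_ hg
      rintro _ ⟨i, hi, rfl⟩
      exact ⟨i, by omega, rfl⟩
    have hcE : ∀ r, Commute (s m) (((List.range m).filter (fun i => i % 2 = r)).map s).prod ∨
        m % 2 ≠ r := by
      intro r
      by_cases hr : m % 2 = r
      · left
        refine Commute.list_prod_right _ _ ?_
        intro x hx
        rw [List.mem_map] at hx
        obtain ⟨i, hi, rfl⟩ := hx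
        rw [List.mem_filter, List.mem_range, decide_eq_true_eq] at hi
        exact (hc i m (by omega)).symm
      · exact Or.inr hr
    rcases Nat.mod_two_eq_zero_or_one m with hm | hm
    · have hE := (hcE 0).resolve_right (by omega)
      -- For even m, s m commutes to the front of the even factors, and the factor (consec s 0 m)⁻¹
      -- rotates it from the front of the run to its end. For odd m it already stands at the end.
      refine ⟨g * (consec s 0 m)⁻¹, mul_mem hg' (inv_mem ?_), ?_⟩
      · refine Subgroup.list_prod_mem _ ?_
        intro x hx
        rw [List.mem_map] at hx
        obtain ⟨i, hi, rfl⟩ := hx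
        exact Subgroup.subset_closure ⟨i, by have := List.mem_range.1 hi; omega, by rw [zero_add]⟩
      · rw [List.range_succ, List.filter_append, List.filter_append, consec_succ]
        simp only [List.filter_cons, hm, decide_true, if_true, List.filter_nil,
          List.map_append, List.prod_append, List.map_cons, List.map_nil, List.prod_cons,
          List.prod_nil, mul_one, zero_ne_one, decide_false, Bool.false_eq_true, if_false]
        rw [← hE.eq, mul_assoc, h, zero_add, mul_inv_rev, inv_inv]
        simp only [← mul_assoc, hcg.eq]
        simp only [mul_assoc, inv_mul_cancel_left]
    · refine ⟨g, hg', ?_⟩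
      rw [List.range_succ, List.filter_append, List.filter_append, consec_succ]
      simp only [List.filter_cons, hm, decide_true, if_true, List.filter_nil,
        List.map_append, List.prod_append, List.map_cons, List.map_nil, List.prod_cons,
        List.prod_nil, mul_one, one_ne_zero, decide_false, Bool.false_eq_true, if_false]
      rw [← mul_assoc, h, zero_add, mul_assoc, ← hcg.inv_right.eq]
      simp only [mul_assoc]

end Consecutive

/-! ### Destabilising the lemniscate braid -/

/-- Adding `m` strands on the right. -/
def liftRight (k : ℕ) : (m : ℕ) → BraidGroup k →* BraidGroup (k + m)
  | 0 => MonoidHom.id _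
  | m + 1 => (shiftRight (k + m)).comp (liftRight k m)

/-- Adding `m` strands on the left. -/
def liftLeft (k : ℕ) : (m : ℕ) → BraidGroup k →* BraidGroup (k + m)
  | 0 => MonoidHom.id _
  | m + 1 => (shiftLeft (k + m)).comp (liftLeft k m)

theorem liftRight_sigma {k i : ℕ} (m : ℕ) (h : i < k) :
    liftRight k m (sigma k i) = sigma (k + m) i := by
  induction m with
  | zero => rfl
  | succ m ih =>
    rw [liftRight, MonoidHom.comp_apply, ih, shiftRight_sigma (by omega)]; rfl

theorem liftLeft_sigma {k i : ℕ} (m : ℕ) (h : i < k) :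
    liftLeft k m (sigma k i) = sigma (k + m) (i + m) := by
  induction m with
  | zero => rfl
  | succ m ih =>
    rw [liftLeft, MonoidHom.comp_apply, ih, shiftLeft_sigma (by omega)]; rfl

/-- Sliding the first run through the second leaves a single occurrence of the top generator, ready
for destabilisation, at the price of one extra bottom generator. -/
theorem consec_sq {k p m : ℕ} (h : p + m < k) :
    consec (sigma k) p (m + 1) * consec (sigma k) p (m + 1) =
      sigma k p * consec (sigma k) p m * sigma k (p + m) * consec (sigma k) p m := by
  have h1 := consec_mul_consec (s := sigma k) (p := p) (m := m)
    (fun _ _ => sigma_commute) m le_rfl (fun i hi => sigma_braid (by omega))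
  nth_rw 1 [consec_succ']
  rw [mul_assoc, h1, consec_succ]
  simp only [mul_assoc]

/-- Each destabilisation shortens the run by one and releases one factor σ_p, which is absorbed into
`Y`; that is why `Y` is arbitrary. -/
theorem closureOf_liftRight_mul_sq (p m : ℕ) (Y : BraidGroup (p + 1)) :
    closureOf (liftRight (p + 1) m Y *
      (consec (sigma (p + 1 + m)) p (m + 1) * consec (sigma (p + 1 + m)) p (m + 1))) =
      closureOf (Y * sigma (p + 1) p ^ (m + 2)) := by
  induction m generalizing Y with
  | zero => rw [consec_one, pow_two]; rfl
  | succ m ih =>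
    have h1 : shiftRight (p + 1 + m) (consec (sigma (p + 1 + m)) p (m + 1)) =
        consec (sigma (p + 1 + m + 1)) p (m + 1) := by
      rw [map_consec]
      exact consec_congr fun i hi => shiftRight_sigma (by omega)
    have h2 := closureOf_destabLast (liftRight (p + 1) m (Y * sigma (p + 1) p) *
      consec (sigma (p + 1 + m)) p (m + 1)) (consec (sigma (p + 1 + m)) p (m + 1))
    have h3 := ih (Y * sigma (p + 1) p)
    rw [mul_assoc, ← pow_succ'] at h3
    rw [← h3]
    refine Eq.trans ?_ (h2.trans (by rw [mul_assoc]))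
    rw [consec_sq (by omega)]
    simp only [map_mul, h1, liftRight_sigma m (Nat.lt_succ_self p),
      shiftRight_sigma (show p < p + 1 + m by omega)]
    simp only [mul_assoc]
    rw [show p + (m + 1) = p + 1 + m by omega]
    rfl

theorem closureOf_right_reduction {k : ℕ} (p m : ℕ) (hk : k = p + 1 + m) :
    closureOf ((consec (fun i => (sigma k i)⁻¹) 0 p * consec (sigma k) p (m + 1)) *
        (consec (fun i => (sigma k i)⁻¹) 0 p * consec (sigma k) p (m + 1))) =
      closureOf (consec (fun i => (sigma (p + 1) i)⁻¹) 0 p * sigma (p + 1) p *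
        consec (fun i => (sigma (p + 1) i)⁻¹) 0 p * sigma (p + 1) p ^ (m + 1)) := by
  subst hk
  have hA : liftRight (p + 1) m (consec (fun i => (sigma (p + 1) i)⁻¹) 0 p) =
      consec (fun i => (sigma (p + 1 + m) i)⁻¹) 0 p := by
    rw [map_consec]
    refine consec_congr fun i hi => ?_
    rw [map_inv, liftRight_sigma _ (by omega)]
  have hs := liftRight_sigma m (Nat.lt_succ_self p)
  have hcomm : Commute (consec (fun i => (sigma (p + 1 + m) i)⁻¹) 0 p)
      (consec (sigma (p + 1 + m)) (p + 1) m) :=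
    commute_consec fun i _ => (commute_consec fun j hj =>
      (sigma_commute (by omega)).symm.inv_right).symm
  -- Put c = σ_p B with B the tail of the run. As B commutes with A, (Ac)² = A σ_p A B c = (A σ_p A
  -- σ_p⁻¹) c².
  have h := closureOf_liftRight_mul_sq p m (consec (fun i => (sigma (p + 1) i)⁻¹) 0 p *
    sigma (p + 1) p * consec (fun i => (sigma (p + 1) i)⁻¹) 0 p * (sigma (p + 1) p)⁻¹)
  have e1 : consec (fun i => (sigma (p + 1) i)⁻¹) 0 p * sigma (p + 1) p *
        consec (fun i => (sigma (p + 1) i)⁻¹) 0 p * sigma (p + 1) p ^ (m + 1) =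
      consec (fun i => (sigma (p + 1) i)⁻¹) 0 p * sigma (p + 1) p *
        consec (fun i => (sigma (p + 1) i)⁻¹) 0 p * (sigma (p + 1) p)⁻¹ *
        sigma (p + 1) p ^ (m + 2) := by
    rw [pow_succ' _ (m + 1)]; group
  rw [e1, ← h]
  simp only [map_mul, map_inv, hA, hs]
  generalize consec (fun i => (sigma (p + 1 + m) i)⁻¹) 0 p = A at *
  congr 1
  rw [consec_succ']
  generalize consec (sigma (p + 1 + m)) (p + 1) m = B at *
  generalize sigma (p + 1 + m) p = x at *
  have : A * (x * B) * (A * (x * B)) = A * x * (B * A) * (x * B) := by group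
  rw [this, ← hcomm.eq]
  group

/-- Mirror image of the reduction on the right: the first generator is isolated in the square of the
negative run, and each step releases one last letter of the run, the image of σ₁⁻¹ of the
three-strand group. -/
theorem closureOf_sq_mul_liftLeft (m : ℕ) (W : BraidGroup 2) :
    closureOf (consec (fun i => (sigma (2 + m) i)⁻¹) 0 (m + 1) *
      consec (fun i => (sigma (2 + m) i)⁻¹) 0 (m + 1) * liftLeft 2 m W) =
      closureOf ((sigma 2 0)⁻¹ ^ (m + 2) * W) := by
  induction m generalizing W with
  | zero => rw [consec_one, pow_two]; rfl
  | succ m ih =>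
    set s : ℕ → BraidGroup (2 + m + 1) := fun i => (sigma (2 + m + 1) i)⁻¹ with hs
    have h1 : shiftLeft (2 + m) (consec (fun i => (sigma (2 + m) i)⁻¹) 0 (m + 1)) =
        consec s 1 (m + 1) := by
      rw [map_consec]
      refine consec_congr fun i hi => ?_
      rw [map_inv, shiftLeft_sigma (by omega), hs]
      simp only [zero_add, add_comm 1]
    have h2 := closureOf_destabFirst (consec (fun i => (sigma (2 + m) i)⁻¹) 0 (m + 1))
      (consec (fun i => (sigma (2 + m) i)⁻¹) 0 (m + 1) * liftLeft 2 m ((sigma 2 0)⁻¹ * W))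
    have h3 := ih ((sigma 2 0)⁻¹ * W)
    have h4 := consec_mul_consec (s := s) (p := 0) (m := m + 1)
      (fun _ _ h => (sigma_commute h).inv_inv) (m + 1) le_rfl (fun i hi => by
        have := sigma_braid (k := 2 + m + 1) (i := 0 + i) (by omega)
        have := congrArg (fun x => x⁻¹) this
        simpa [mul_assoc] using this)
    rw [← mul_assoc, ← pow_succ] at h3
    rw [← h3]
    refine Eq.trans ?_ (h2.trans (by rw [mul_assoc]))
    simp only [map_mul, map_inv, h1, liftLeft_sigma m (show 0 < 2 by omega),
      shiftLeft_sigma (show 0 + m < 2 + m by omega)]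
    congr 1
    have h5 : consec s 0 (m + 1 + 1) = consec s 0 (m + 1) * s (m + 1) := by
      rw [consec_succ, zero_add]
    have h6 : consec s 0 (m + 1 + 1) = s 0 * consec s 1 (m + 1) := consec_succ' _ _ _
    rw [show (fun i => (sigma (2 + (m + 1)) i)⁻¹) = s from rfl]
    nth_rw 2 [h5]
    rw [← mul_assoc, ← h4, h6, show (0 + m + 1) = m + 1 by omega]
    simp only [hs, mul_assoc, zero_add]
    rfl

theorem closureOf_left_reduction {k : ℕ} (m q : ℕ) (hk : k = 2 + m) :
    closureOf (consec (fun i => (sigma k i)⁻¹) 0 (m + 1) * sigma k (m + 1) *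
        consec (fun i => (sigma k i)⁻¹) 0 (m + 1) * sigma k (m + 1) ^ q) =
      closureOf ((sigma 2 0)⁻¹ ^ (m + 1) * sigma 2 1 * (sigma 2 0)⁻¹ * sigma 2 1 ^ q) := by
  subst hk
  -- Here A = B σ_m⁻¹, and x = σ_{m+1} commutes with B. Hence A x A = A² (σ_m x σ_m⁻¹), which makes
  -- the square of the run appear.
  have h := closureOf_sq_mul_liftLeft m
    (sigma 2 0 * sigma 2 1 * (sigma 2 0)⁻¹ * sigma 2 1 ^ q)
  have e1 : (sigma 2 0)⁻¹ ^ (m + 1) * sigma 2 1 * (sigma 2 0)⁻¹ * sigma 2 1 ^ q =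
      (sigma 2 0)⁻¹ ^ (m + 2) * (sigma 2 0 * sigma 2 1 * (sigma 2 0)⁻¹ * sigma 2 1 ^ q) := by
    rw [pow_succ _ (m + 1)]; group
  rw [e1, ← h]
  simp only [map_mul, map_inv, map_pow, liftLeft_sigma m (show 0 < 2 by omega),
    liftLeft_sigma m (show 1 < 2 by omega)]
  congr 1
  have hcomm : Commute (sigma (2 + m) (m + 1)) (consec (fun i => (sigma (2 + m) i)⁻¹) 0 m) :=
    commute_consec fun i hi => (sigma_commute (by omega)).symm.inv_right
  have h5 : consec (fun i => (sigma (2 + m) i)⁻¹) 0 (m + 1) =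
      consec (fun i => (sigma (2 + m) i)⁻¹) 0 m * (sigma (2 + m) m)⁻¹ := by
    rw [consec_succ, zero_add]
  rw [zero_add, add_comm 1 m]
  nth_rw 2 [h5]
  nth_rw 3 [h5]
  generalize consec (fun i => (sigma (2 + m) i)⁻¹) 0 (m + 1) = A
  generalize consec (fun i => (sigma (2 + m) i)⁻¹) 0 m = B at *
  generalize sigma (2 + m) (m + 1) = x at *
  have : A * x * (B * (sigma (2 + m) m)⁻¹) * x ^ q = A * (x * B) * (sigma (2 + m) m)⁻¹ * x ^ q := by
    group
  rw [this, hcomm.eq]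
  group

theorem toBraid_minimalWord (n : ℕ) :
    (minimalWord n).toBraid =
      (sigma 2 0)⁻¹ * sigma 2 1 ^ n * (sigma 2 0)⁻¹ ^ n * sigma 2 1 := by
  simp [minimalWord, toBraid_eq_prod, letterBraid_eq, mul_assoc]

/-- The generators of the lemniscate braid, with their signs. -/
def signedSigma (n i : ℕ) : BraidGroup (2 * n) :=
  if n ≤ i then sigma (2 * n) i else (sigma (2 * n) i)⁻¹

theorem signedSigma_commute {n i j : ℕ} (h : i + 1 < j) :
    Commute (signedSigma n i) (signedSigma n j) := by
  have := sigma_commute (k := 2 * n) h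
  unfold signedSigma
  split_ifs
  exacts [this, this.inv_right, this.inv_left, this.inv_inv]

theorem closureOf_lemniscate_braid {n : ℕ} (hn : 1 ≤ n) :
    closureOf (
      (((List.range (2 * n)).filter (fun i => i % 2 = 0)).map (signedSigma n)).prod *
        (((List.range (2 * n)).filter (fun i => i % 2 = 1)).map (signedSigma n)).prod *
      ((((List.range (2 * n)).filter (fun i => i % 2 = 0)).map (signedSigma n)).prod *
        (((List.range (2 * n)).filter (fun i => i % 2 = 1)).map (signedSigma n)).prod)) =
      (minimalWord n).closure := by
  obtain ⟨g, -, h⟩ := exists_conj_even_odd (s := signedSigma n)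
    (fun _ _ => signedSigma_commute) (2 * n)
  obtain ⟨m, rfl⟩ : ∃ m, n = m + 1 := ⟨n - 1, by omega⟩
  have h1 : consec (signedSigma (m + 1)) 0 (2 * (m + 1)) =
      consec (fun i => (sigma (2 * (m + 1)) i)⁻¹) 0 (m + 1) *
        consec (sigma (2 * (m + 1))) (m + 1) (m + 1) := by
    have := consec_add (signedSigma (m + 1)) 0 (m + 1) (m + 1)
    rw [← two_mul] at this
    rw [this]
    congr 1
    · exact consec_congr fun i hi => if_neg (by omega)
    · exact consec_congr fun i hi => (if_pos (by omega)).trans (by rw [zero_add])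
  have h2 : ∀ x : BraidGroup (2 * (m + 1)), g * x * g⁻¹ * (g * x * g⁻¹) = g * (x * x) * g⁻¹ := by
    intro x; group
  -- Both halves of the run have n = m + 1 letters. The reductions give σ₁⁻ⁿ σ₂ σ₁⁻¹ σ₂ⁿ, a cyclic
  -- rotation of the minimal word.
  rw [h, h2, closureOf_conj, h1, closureOf_right_reduction (m + 1) m (by omega),
    closureOf_left_reduction m (m + 1) (by omega), ← closureOf_toBraid, toBraid_minimalWord,
    mul_assoc ((sigma 2 0)⁻¹ ^ (m + 1) * _), closureOf_mul_comm]
  simp only [mul_assoc]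

/-! ### The crossings of the lemniscate braid -/

/-- At height `N * π / 2` the angle of the strand `p` is `π * slot n N p / (2 * n + 1)`, up to
multiples of `2 * π`. -/
def slot (n N p : ℕ) : ℤ :=
  if N + 2 * p ≤ 2 * n + 1 then (N + 2 * p : ℤ) else (N + 2 * p : ℤ) - (4 * n + 2)

theorem slot_inj {n N p q : ℕ} (hp : p < 2 * n + 1) (hq : q < 2 * n + 1)
    (h : slot n N p = slot n N q) : p = q := by
  unfold slot at h; split_ifs at h <;> omega

theorem slot_bounds {n N p : ℕ} (hn : 1 ≤ n) (hN : 1 ≤ N ∧ N ≤ 4) (hp : p < 2 * n + 1) :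
    -(2 * n) ≤ slot n N p ∧ slot n N p ≤ 2 * n + 1 := by
  unfold slot; split_ifs <;> omega

theorem slot_mod_two (n N p : ℕ) : (slot n N p - N) % 2 = 0 := by
  unfold slot; split_ifs <;> omega

theorem exists_slot_eq {n N : ℕ} (hn : 1 ≤ n) (hN : 1 ≤ N ∧ N ≤ 4) {v : ℤ} (h1 : -(2 * n) ≤ v)
    (h2 : v ≤ 2 * n) (h3 : (v - N) % 2 = 0) : ∃ p : Fin (2 * n + 1), slot n N p = v := by
  by_cases hv : N ≤ v
  · refine ⟨⟨((v - N) / 2).toNat, by omega⟩, ?_⟩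
    unfold slot; dsimp only; split_ifs <;> omega
  · refine ⟨⟨((v - N) / 2 + (2 * n + 1)).toNat, by omega⟩, ?_⟩
    unfold slot; dsimp only; split_ifs <;> omega

/-- The strands to the left of slots ±c are consecutive around the circle: modulo 4n+2 their slots
run from c+2 to 4n-c in steps of 2. The bijection with an initial segment is therefore a cyclic
shift by d - 1. -/
theorem ncard_slot {n N c : ℕ} (hn : 1 ≤ n) (hN : 1 ≤ N ∧ N ≤ 4) (hc : c ≤ 2 * n)
    (hcN : (c + N) % 2 = 0) :
    Set.ncard {m : Fin (2 * n + 1) | c < (slot n N m).natAbs} = 2 * n - c := by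
  classical
  rw [Set.ncard_eq_toFinset_card', ← Finset.card_range (2 * n - c)]
  obtain ⟨d, hd⟩ : ∃ d : ℤ, (N : ℤ) - c = 2 * d := ⟨((N : ℤ) - c) / 2, by omega⟩
  refine Finset.card_bij'
    (fun m _ => (if (m : ℤ) + d > 2 * n + 1 then (m : ℤ) + d - (2 * n + 2) else m + d - 1).toNat)
    (fun r hr => ⟨(if 0 ≤ (r : ℤ) + 1 - d then (r : ℤ) + 1 - d
      else (r : ℤ) + 1 - d + (2 * n + 1)).toNat, ?_⟩) ?_ ?_ ?_ ?_
  · rw [Finset.mem_range] at hr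
    split_ifs <;> omega
  · intro m hm
    have := m.isLt
    rw [Set.mem_toFinset, Set.mem_ofPred_eq] at hm
    unfold slot at hm
    rw [Finset.mem_range]
    split_ifs at hm ⊢ <;> omega
  · intro r hr
    rw [Finset.mem_range] at hr
    rw [Set.mem_toFinset, Set.mem_ofPred_eq]
    unfold slot
    dsimp only
    split_ifs <;> omega
  · intro m hm
    have := m.isLt
    rw [Set.mem_toFinset, Set.mem_ofPred_eq] at hm
    unfold slot at hm
    ext1
    dsimp only
    split_ifs at hm ⊢ <;> omega
  · intro r hr
    rw [Finset.mem_range] at hr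
    dsimp only
    split_ifs <;> omega

theorem strandX_eq (n N p : ℕ) (hp : p < 2 * n + 1) (a y : ℝ) :
    strandX (2 * n + 1) 2 a ⟨p, hp⟩ y = a * Real.cos (Real.pi * slot n N p / (2 * n + 1) +
      2 * (y - N * Real.pi / 2) / (2 * n + 1)) := by
  have hs : (2 * n + 1 : ℝ) ≠ 0 := by positivity
  unfold strandX slot
  congr 1
  split_ifs
  · congr 1; push_cast; field_simp; ring
  · rw [← Real.cos_sub_two_pi]; congr 1; push_cast; field_simp; ring

theorem strandY_eq (n N p : ℕ) (hp : p < 2 * n + 1) (b : ℝ) :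
    strandY (2 * n + 1) 2 2 b ⟨p, hp⟩ (N * Real.pi / 2) =
      b / 2 * Real.sin (2 * (Real.pi * slot n N p / (2 * n + 1))) := by
  have hs : (2 * n + 1 : ℝ) ≠ 0 := by positivity
  unfold strandY slot
  push_cast
  congr 1
  split_ifs
  · congr 1; field_simp
  · rw [← Real.sin_sub_two_pi, ← Real.sin_sub_two_pi]; congr 1; field_simp; ring

theorem strandX_eq_cos_natAbs (n N p : ℕ) (hp : p < 2 * n + 1) (a : ℝ) :
    strandX (2 * n + 1) 2 a ⟨p, hp⟩ (N * Real.pi / 2) =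
      a * Real.cos (Real.pi * (slot n N p).natAbs / (2 * n + 1)) := by
  rw [strandX_eq n N p hp, sub_self, mul_zero, zero_div, add_zero, ← Real.cos_abs, Nat.cast_natAbs,
    abs_div, abs_mul, abs_of_pos Real.pi_pos, abs_of_pos (show (0 : ℝ) < 2 * n + 1 by positivity),
    Int.cast_abs]

theorem cos_lt_cos_iff {n c d : ℕ} (hc : c ≤ 2 * n + 1) (hd : d ≤ 2 * n + 1) {a : ℝ} (ha : 0 < a) :
    a * Real.cos (Real.pi * c / (2 * n + 1)) < a * Real.cos (Real.pi * d / (2 * n + 1)) ↔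
      d < c := by
  have hs : (0 : ℝ) < 2 * n + 1 := by positivity
  have h : ∀ c : ℕ, c ≤ 2 * n + 1 → Real.pi * c / (2 * n + 1) ∈ Set.Icc 0 Real.pi := by
    intro c hc
    have : (c : ℝ) ≤ 2 * n + 1 := by exact_mod_cast hc
    refine ⟨by positivity, ?_⟩
    rw [div_le_iff₀ hs]
    exact mul_le_mul_of_nonneg_left this Real.pi_pos.le
  rw [mul_lt_mul_iff_right₀ ha, Real.strictAntiOn_cos.lt_iff_gt (h c hc) (h d hd),
    div_lt_div_iff_of_pos_right hs, mul_lt_mul_iff_right₀ Real.pi_pos, Nat.cast_lt]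

section Crossing

variable {n N : ℕ} {a b : ℝ}

theorem strandX_lt_iff (hn : 1 ≤ n) (hN : 1 ≤ N ∧ N ≤ 4) (ha : 0 < a) (p q : Fin (2 * n + 1)) :
    strandX (2 * n + 1) 2 a p (N * Real.pi / 2) < strandX (2 * n + 1) 2 a q (N * Real.pi / 2) ↔
      (slot n N q).natAbs < (slot n N p).natAbs := by
  have h1 := slot_bounds hn hN p.isLt
  have h2 := slot_bounds hn hN q.isLt
  rw [strandX_eq_cos_natAbs n N p p.isLt, strandX_eq_cos_natAbs n N q q.isLt]
  exact cos_lt_cos_iff (by omega) (by omega) ha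

theorem strandX_eq_iff (hn : 1 ≤ n) (hN : 1 ≤ N ∧ N ≤ 4) (ha : 0 < a) (p q : Fin (2 * n + 1)) :
    strandX (2 * n + 1) 2 a p (N * Real.pi / 2) = strandX (2 * n + 1) 2 a q (N * Real.pi / 2) ↔
      (slot n N p).natAbs = (slot n N q).natAbs := by
  have h1 := strandX_lt_iff hn hN ha p q
  have h2 := strandX_lt_iff hn hN ha q p
  constructor
  · intro h
    have h3 := h.not_lt
    have h4 := h.symm.not_lt
    rw [h1] at h3; rw [h2] at h4
    omega
  · intro h
    exact le_antisymm (not_lt.1 (by rw [h2]; omega)) (not_lt.1 (by rw [h1]; omega))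

theorem slot_eq_neg_of_meet (hn : 1 ≤ n) (hN : 1 ≤ N ∧ N ≤ 4) (ha : 0 < a)
    {p q : Fin (2 * n + 1)} (hpq : p ≠ q)
    (h : strandX (2 * n + 1) 2 a p (N * Real.pi / 2) = strandX (2 * n + 1) 2 a q (N * Real.pi / 2)) :
    slot n N q = -slot n N p ∧ slot n N p ≠ 0 ∧ (slot n N p).natAbs ≤ 2 * n := by
  rw [strandX_eq_iff hn hN ha] at h
  have h1 := slot_bounds hn hN p.isLt
  have h2 := slot_bounds hn hN q.isLt
  have h3 : slot n N p ≠ slot n N q := fun h => hpq (Fin.ext (slot_inj (N := N) p.isLt q.isLt h))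
  omega

/-- The difference of the two coordinates is a product of sines that changes sign exactly with y -
N·π/2. The strand in the positive slot is on the left just above the crossing. -/
theorem eventually_strandX_lt (ha : 0 < a)
    {p q : Fin (2 * n + 1)} (hpq : slot n N q = -slot n N p) (h : 0 < slot n N p)
    (h' : slot n N p ≤ 2 * n) :
    (∀ᶠ y in 𝓝[>] (N * Real.pi / 2 : ℝ),
        strandX (2 * n + 1) 2 a p y < strandX (2 * n + 1) 2 a q y) ∧
      (∀ᶠ y in 𝓝[<] (N * Real.pi / 2 : ℝ),
        strandX (2 * n + 1) 2 a q y < strandX (2 * n + 1) 2 a p y) := by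
  have hs : (0 : ℝ) < 2 * n + 1 := by positivity
  have hs1 : (1 : ℝ) ≤ 2 * n + 1 := by linarith [(Nat.cast_nonneg n : (0 : ℝ) ≤ n)]
  have h0 : (0 : ℝ) < slot n N p := by exact_mod_cast h
  have h0' : (slot n N p : ℝ) ≤ 2 * n := by exact_mod_cast h'
  have hsin : 0 < Real.sin (Real.pi * slot n N p / (2 * n + 1)) := by
    refine Real.sin_pos_of_pos_of_lt_pi (by have := Real.pi_pos; positivity) ?_
    rw [div_lt_iff₀ hs]
    exact mul_lt_mul_of_pos_left (by linarith) Real.pi_pos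
  have key : ∀ y, strandX (2 * n + 1) 2 a q y - strandX (2 * n + 1) 2 a p y =
      2 * a * Real.sin (Real.pi * slot n N p / (2 * n + 1)) *
        Real.sin (2 * (y - N * Real.pi / 2) / (2 * n + 1)) := by
    intro y
    rw [strandX_eq n N p p.isLt, strandX_eq n N q q.isLt, hpq, Int.cast_neg, mul_neg, neg_div,
      Real.cos_add, Real.cos_add, Real.cos_neg, Real.sin_neg]
    ring
  have hpos : 0 < 2 * a * Real.sin (Real.pi * slot n N p / (2 * n + 1)) := by positivity
  constructor
  · filter_upwards [Ioo_mem_nhdsGT (show (N * Real.pi / 2 : ℝ) < N * Real.pi / 2 + 1 by linarith)]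
      with y hy
    rw [← sub_pos, key]
    refine mul_pos hpos (Real.sin_pos_of_pos_of_lt_pi ?_ ?_)
    · exact div_pos (by linarith [hy.1]) hs
    · rw [div_lt_iff₀ hs]
      nlinarith [Real.pi_gt_three, hy.2]
  · filter_upwards [Ioo_mem_nhdsLT (show (N * Real.pi / 2 - 1 : ℝ) < N * Real.pi / 2 by linarith)]
      with y hy
    rw [← sub_neg, key]
    refine mul_neg_of_pos_of_neg hpos (Real.sin_neg_of_neg_of_neg_pi_lt ?_ ?_)
    · exact div_neg_of_neg_of_pos (by linarith [hy.2]) hs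
    · rw [lt_div_iff₀ hs]
      nlinarith [Real.pi_gt_three, hy.1]

theorem sin_two_mul_pos {c : ℤ} (h0 : 0 < c) (h1 : c ≤ n) :
    0 < Real.sin (2 * (Real.pi * c / (2 * n + 1))) := by
  have hs : (0 : ℝ) < 2 * n + 1 := by positivity
  have h0' : (0 : ℝ) < c := by exact_mod_cast h0
  have h1' : (c : ℝ) ≤ n := by exact_mod_cast h1
  refine Real.sin_pos_of_pos_of_lt_pi (by have := Real.pi_pos; positivity) ?_
  rw [← mul_div_assoc, div_lt_iff₀ hs]
  nlinarith [Real.pi_pos]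

theorem sin_two_mul_neg {c : ℤ} (h0 : n < c) (h1 : c ≤ 2 * n) :
    Real.sin (2 * (Real.pi * c / (2 * n + 1))) < 0 := by
  have hs : (0 : ℝ) < 2 * n + 1 := by positivity
  have h0' : (n : ℝ) + 1 ≤ c := by exact_mod_cast h0
  have h1' : (c : ℝ) ≤ 2 * n := by exact_mod_cast h1
  rw [← Real.sin_sub_two_pi]
  refine Real.sin_neg_of_neg_of_neg_pi_lt ?_ ?_
  · rw [sub_neg, ← mul_div_assoc, div_lt_iff₀ hs]
    nlinarith [Real.pi_pos]
  · rw [lt_sub_iff_add_lt, ← mul_div_assoc, lt_div_iff₀ hs]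
    nlinarith [Real.pi_pos]

/-- The slot of the overcrossing strand at the crossing in position `g`. -/
def overSlot (n g : ℕ) : ℤ := if n ≤ g then 2 * n - g else g - 2 * n

/-- The second coordinates at a meeting are opposite, so the upper strand is the one with sin 2θ >
0: its slot is in (0, n] or in [-2n, -n). The first case gives a positive crossing in a position at
least n, the second a negative one further left. -/
theorem IsCrossing.slots (hn : 1 ≤ n) (hN : 1 ≤ N ∧ N ≤ 4) (ha : 0 < a) (hb : 0 < b)
    {p q : Fin (2 * n + 1)} {x : Fin (2 * n) × Bool}
    (h : IsCrossing (strandX (2 * n + 1) 2 a) (strandY (2 * n + 1) 2 2 b) (N * Real.pi / 2) p q x) :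
    ((x.1 : ℕ) + N) % 2 = 0 ∧ x.2 = decide (n ≤ x.1) ∧
      slot n N p = overSlot n x.1 ∧ slot n N q = -overSlot n x.1 := by
  have hpq : p ≠ q := by rintro rfl; exact lt_irrefl _ h.higher
  obtain ⟨h1, h2, h3⟩ := slot_eq_neg_of_meet hn hN ha hpq h.meet
  have hmod := slot_mod_two n N p
  have hpos := h.position
  simp only [strandX_lt_iff hn hN ha] at hpos
  rw [ncard_slot hn hN h3 (by omega)] at hpos
  have hY := h.higher
  have hpY := strandY_eq n N p p.isLt b
  have hqY := strandY_eq n N q q.isLt b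
  simp only [Fin.eta] at hpY hqY
  rw [hpY, hqY, h1, Int.cast_neg, mul_neg, neg_div, mul_neg, Real.sin_neg] at hY
  have hY' : 0 < Real.sin (2 * (Real.pi * slot n N p / (2 * n + 1))) := by
    by_contra hcon
    nlinarith
  rcases lt_or_gt_of_ne h2 with hlt | hgt
  · have e1 : (n : ℤ) < -slot n N p := by
      by_contra hcon
      have := sin_two_mul_pos (n := n) (c := -slot n N p) (by omega) (by omega)
      rw [Int.cast_neg, mul_neg, neg_div, mul_neg, Real.sin_neg] at this
      linarith
    have e2 : x.2 = false := by
      by_contra hcon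
      have h4 := (h.pos (by simpa using hcon)).1
      have h5 := (eventually_strandX_lt (N := N) ha (p := q) (q := p) (by omega) (by omega)
        (by omega)).1
      obtain ⟨y, hy1, hy2⟩ := (h4.and h5).exists
      exact lt_asymm hy1 hy2
    refine ⟨by omega, ?_, ?_⟩
    · rw [e2]; symm; rw [decide_eq_false_iff_not]; omega
    · unfold overSlot; rw [if_neg (by omega)]; omega
  · have e1 : slot n N p ≤ n := by
      by_contra hcon
      have := sin_two_mul_neg (n := n) (c := slot n N p) (by omega) (by omega)
      linarith
    have e2 : x.2 = true := by
      by_contra hcon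
      have h4 := (h.neg (by simpa using hcon)).1
      have h5 := (eventually_strandX_lt (N := N) ha (p := p) (q := q) (by omega) (by omega)
        (by omega)).1
      obtain ⟨y, hy1, hy2⟩ := (h4.and h5).exists
      exact lt_asymm hy1 hy2
    refine ⟨by omega, ?_, ?_⟩
    · rw [e2]; symm; rw [decide_eq_true_iff]; omega
    · unfold overSlot; rw [if_pos (by omega)]; omega

theorem isCrossing_of_slots (hn : 1 ≤ n) (hN : 1 ≤ N ∧ N ≤ 4) (ha : 0 < a) (hb : 0 < b)
    {p q : Fin (2 * n + 1)} {g : Fin (2 * n)} (hp : slot n N p = overSlot n g)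
    (hq : slot n N q = -overSlot n g) :
    IsCrossing (strandX (2 * n + 1) 2 a) (strandY (2 * n + 1) 2 2 b) (N * Real.pi / 2) p q
      (g, decide (n ≤ (g : ℕ))) := by
  have hg := g.isLt
  have hmod := slot_mod_two n N p
  have hpY := strandY_eq n N p p.isLt b
  have hqY := strandY_eq n N q q.isLt b
  simp only [Fin.eta] at hpY hqY
  have habs : (slot n N p).natAbs = 2 * n - g := by
    rw [hp]; unfold overSlot; split_ifs <;> omega
  have hY : 0 < Real.sin (2 * (Real.pi * slot n N p / (2 * n + 1))) := by
    unfold overSlot at hp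
    split_ifs at hp with hc
    · exact sin_two_mul_pos (by omega) (by omega)
    · have := sin_two_mul_neg (n := n) (c := -slot n N p) (by omega) (by omega)
      rw [Int.cast_neg, mul_neg, neg_div, mul_neg, Real.sin_neg] at this
      linarith
  refine ⟨?_, ?_, ?_, ?_, ?_, ?_⟩
  · rw [strandX_eq_iff hn hN ha]; omega
  · rw [hpY, hqY, hq, ← hp, Int.cast_neg, mul_neg, neg_div, mul_neg, Real.sin_neg]
    nlinarith
  · intro m hm
    rw [strandX_eq_iff hn hN ha] at hm
    rcases Int.natAbs_eq_natAbs_iff.1 hm with hm | hm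
    · exact Or.inl (Fin.ext (slot_inj (N := N) m.isLt p.isLt hm))
    · exact Or.inr (Fin.ext (slot_inj (N := N) m.isLt q.isLt (by omega)))
  · simp only [strandX_lt_iff hn hN ha]
    rw [ncard_slot hn hN (by omega) (by omega)]
    omega
  · intro hc
    rw [decide_eq_true_iff] at hc
    unfold overSlot at hp hq
    rw [if_pos hc] at hp hq
    exact eventually_strandX_lt (N := N) ha (by omega) (by omega) (by omega)
  · intro hc
    rw [decide_eq_false_iff_not] at hc
    unfold overSlot at hp hq
    rw [if_neg hc] at hp hq
    exact eventually_strandX_lt (N := N) ha (by omega) (by omega) (by omega)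

/-- Equal cosines mean equal or opposite angles modulo 2π. Equal angles would make p - q a multiple
of 2n+1, hence zero; opposite ones make y an integer multiple of π/2. -/
theorem exists_height_of_meet (ha : 0 < a) {p q : Fin (2 * n + 1)} (hpq : p ≠ q) {y : ℝ}
    (hy : y ∈ Set.Ioc 0 (2 * Real.pi))
    (h : strandX (2 * n + 1) 2 a p y = strandX (2 * n + 1) 2 a q y) :
    ∃ N : ℕ, (1 ≤ N ∧ N ≤ 4) ∧ y = N * Real.pi / 2 := by
  have hs : (0 : ℝ) < 2 * n + 1 := by positivity
  have hpi := Real.pi_pos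
  unfold strandX at h
  have h1 := mul_left_cancel₀ ha.ne' h
  rw [Real.cos_eq_cos_iff] at h1
  obtain ⟨k, hk⟩ := h1
  push_cast at hk
  rcases hk with hk | hk
  · exfalso
    have h2 : (q : ℝ) - p = k * (2 * n + 1) := by
      field_simp at hk
      apply mul_left_cancel₀ (show 2 * Real.pi ≠ 0 by positivity)
      linarith
    have h3 : ((q : ℕ) : ℤ) - (p : ℕ) = k * (2 * n + 1) := by exact_mod_cast h2
    have hq := q.isLt
    have hp := p.isLt
    have hk0 : k = 0 := by
      rcases lt_trichotomy k 0 with hk | hk | hk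
      · nlinarith
      · exact hk
      · nlinarith
    rw [hk0] at h3
    exact hpq (Fin.ext (by omega))
  · have h2 : y = ((k * (2 * n + 1) - p - q : ℤ) : ℝ) * Real.pi / 2 := by
      push_cast
      field_simp at hk
      linarith
    generalize k * (2 * n + 1) - (p : ℕ) - (q : ℕ) = N at h2
    have h3 : (0 : ℝ) < N := by
      by_contra hcon
      have : (N : ℝ) * Real.pi ≤ 0 := mul_nonpos_of_nonpos_of_nonneg (not_lt.1 hcon) hpi.le
      linarith [hy.1]
    have h4 : (N : ℝ) ≤ 4 := by
      by_contra hcon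
      nlinarith [hy.2]
    have h3' : 0 < N := by exact_mod_cast h3
    have h4' : N ≤ 4 := by exact_mod_cast h4
    lift N to ℕ using h3'.le
    exact ⟨N, by omega, by simpa using h2⟩

end Crossing

/-! ### Reading the braid word -/

theorem filter_append_filter_of_sorted {α : Type*} (key : α → ℕ) (K : ℕ) (l : List α)
    (hs : l.Pairwise fun x y => key y ≤ key x) (hK : ∀ x ∈ l, key x ≤ K + 1) :
    l = l.filter (fun x => key x = K + 1) ++ l.filter (fun x => key x ≤ K) := by
  induction l with
  | nil => rfl
  | cons a l ih =>
    rw [List.pairwise_cons] at hs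
    by_cases ha : key a = K + 1
    · have ha' : ¬ key a ≤ K := by omega
      rw [List.filter_cons_of_pos (by simpa using ha), List.filter_cons_of_neg (by simpa using ha'),
        List.cons_append, ← ih hs.2 fun x hx => hK x (List.mem_cons_of_mem _ hx)]
    · have ha' : key a ≤ K := by have := hK a List.mem_cons_self; omega
      have h1 : l.filter (fun x => key x = K + 1) = [] := by
        rw [List.filter_eq_nil_iff]
        intro x hx
        have := hs.1 x hx
        simp only [decide_eq_true_eq]; omega
      have h2 : l.filter (fun x => key x ≤ K) = l := by
        rw [List.filter_eq_self]
        intro x hx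
        have := hs.1 x hx
        simp only [decide_eq_true_eq]; omega
      rw [List.filter_cons_of_neg (by simpa using ha), List.filter_cons_of_pos (by simpa using ha'),
        h1, h2, List.nil_append]

theorem prod_map_eq_of_perm_of_commute {α G : Type*} [Monoid G] (f : α → G) {l l' : List α}
    (h : l.Perm l') (hc : ∀ x ∈ l, ∀ y ∈ l, Commute (f x) (f y)) :
    (l.map f).prod = (l'.map f).prod := by
  refine (h.map f).prod_eq' ?_
  rw [List.pairwise_map]
  exact List.pairwise_of_forall_mem_list fun x hx y hy => hc x hx y hy

/-- A sorted list is a concatenation of blocks of constant key, and within a block the factors may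
be permuted. Applied to heights, this makes the braid independent of the order chosen at each level.
-/
theorem prod_map_eq_of_sorted {α G : Type*} [Monoid G] (f : α → G) (key : α → ℕ) (K : ℕ)
    {l l' : List α} (h : l.Perm l') (hs : l.Pairwise fun x y => key y ≤ key x)
    (hs' : l'.Pairwise fun x y => key y ≤ key x) (hK : ∀ x ∈ l, key x ≤ K)
    (hc : ∀ x ∈ l, ∀ y ∈ l, key x = key y → Commute (f x) (f y)) :
    (l.map f).prod = (l'.map f).prod := by
  induction K generalizing l l' with
  | zero =>
    refine prod_map_eq_of_perm_of_commute f h fun x hx y hy => hc x hx y hy ?_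
    rw [Nat.le_zero.1 (hK x hx), Nat.le_zero.1 (hK y hy)]
  | succ K ih =>
    rw [filter_append_filter_of_sorted key K l hs hK,
      filter_append_filter_of_sorted key K l' hs' fun x hx => hK x (h.mem_iff.2 hx)]
    rw [List.map_append, List.map_append, List.prod_append, List.prod_append]
    congr 1
    · refine prod_map_eq_of_perm_of_commute f (h.filter _) fun x hx y hy => ?_
      rw [List.mem_filter, decide_eq_true_eq] at hx hy
      exact hc x hx.1 y hy.1 (hx.2.trans hy.2.symm)
    · refine ih (h.filter _) (hs.filter _) (hs'.filter _) (fun x hx => ?_) fun x hx y hy => ?_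
      · rw [List.mem_filter, decide_eq_true_eq] at hx
        exact hx.2
      · exact hc x (List.mem_of_mem_filter hx) y (List.mem_of_mem_filter hy)

/-- The pairs of a height index and a letter that occur in the lemniscate braid. -/
def IsEntry (n : ℕ) (z : ℕ × Fin (2 * n) × Bool) : Prop :=
  (1 ≤ z.1 ∧ z.1 ≤ 4) ∧ ((z.2.1 : ℕ) + z.1) % 2 = 0 ∧ z.2.2 = decide (n ≤ (z.2.1 : ℕ))

theorem IsEntry.letterBraid_eq {n : ℕ} {z : ℕ × Fin (2 * n) × Bool} (h : IsEntry n z) :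
    letterBraid z.2 = signedSigma n z.2.1 := by
  rw [LemniscateKnot.letterBraid_eq, h.2.2, signedSigma]
  simp only [decide_eq_true_eq]

theorem IsEntry.commute {n : ℕ} {z z' : ℕ × Fin (2 * n) × Bool} (h : IsEntry n z)
    (h' : IsEntry n z') (he : z.1 = z'.1) : Commute (letterBraid z.2) (letterBraid z'.2) := by
  rw [h.letterBraid_eq, h'.letterBraid_eq]
  have h1 := h.2.1
  have h2 := h'.2.1
  rcases lt_trichotomy (z.2.1 : ℕ) z'.2.1 with h3 | h3 | h3
  · exact signedSigma_commute (by omega)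
  · rw [h3]
  · exact (signedSigma_commute (by omega)).symm

/-- The entries of height index `N`, from left to right. -/
def level (n N : ℕ) : List (ℕ × Fin (2 * n) × Bool) :=
  ((List.finRange (2 * n)).filter fun g : Fin (2 * n) => ((g : ℕ) + N) % 2 = 0).map
    fun g : Fin (2 * n) => (N, g, decide (n ≤ (g : ℕ)))

/-- The entries of the lemniscate braid, level by level. -/
def entries (n : ℕ) : List (ℕ × Fin (2 * n) × Bool) :=
  level n 4 ++ (level n 3 ++ (level n 2 ++ level n 1))

theorem mem_level {n N : ℕ} {z : ℕ × Fin (2 * n) × Bool} :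
    z ∈ level n N ↔ z.1 = N ∧ ((z.2.1 : ℕ) + N) % 2 = 0 ∧ z.2.2 = decide (n ≤ (z.2.1 : ℕ)) := by
  simp only [level, List.mem_map, List.mem_filter, List.mem_finRange, true_and, decide_eq_true_eq]
  constructor
  · rintro ⟨g, hg, rfl⟩
    exact ⟨rfl, hg, rfl⟩
  · rintro ⟨h1, h2, h3⟩
    exact ⟨z.2.1, h2, Prod.ext h1.symm (Prod.ext rfl h3.symm)⟩

theorem mem_entries {n : ℕ} {z : ℕ × Fin (2 * n) × Bool} : z ∈ entries n ↔ IsEntry n z := by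
  simp only [entries, List.mem_append, mem_level, IsEntry]
  constructor
  · rintro (⟨h1, h2, h3⟩ | ⟨h1, h2, h3⟩ | ⟨h1, h2, h3⟩ | ⟨h1, h2, h3⟩) <;> rw [h1] <;>
      exact ⟨by omega, h2, h3⟩
  · rintro ⟨h1, h2, h3⟩
    obtain h | h | h | h : z.1 = 4 ∨ z.1 = 3 ∨ z.1 = 2 ∨ z.1 = 1 := by omega
    all_goals rw [h] at h2; simp [h, h2, h3]

theorem nodup_level (n N : ℕ) : (level n N).Nodup := by
  refine ((List.nodup_finRange _).filter _).map fun x y hxy => ?_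
  exact (Prod.ext_iff.1 (Prod.ext_iff.1 hxy).2).1

theorem nodup_entries (n : ℕ) : (entries n).Nodup := by
  have hd : ∀ {N : ℕ} {l : List (ℕ × Fin (2 * n) × Bool)}, l.Nodup → (∀ z ∈ l, z.1 < N) →
      (level n N ++ l).Nodup := by
    intro N l h1 h2
    refine (nodup_level n N).append h1 fun z hz hz' => ?_
    exact (h2 z hz').ne (mem_level.1 hz).1
  refine hd (hd (hd (nodup_level n 1) ?_) ?_) ?_ <;>
    · intro z hz
      simp only [List.mem_append, mem_level] at hz
      omega

theorem sorted_entries (n : ℕ) : (entries n).Pairwise fun x y => y.1 ≤ x.1 := by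
  have hl : ∀ N, (level n N).Pairwise fun x y => y.1 ≤ x.1 := fun N =>
    List.pairwise_of_forall_mem_list fun x hx y hy => by
      rw [(mem_level.1 hx).1, (mem_level.1 hy).1]
  have hd : ∀ {N : ℕ} {l : List (ℕ × Fin (2 * n) × Bool)}, (l.Pairwise fun x y => y.1 ≤ x.1) →
      (∀ z ∈ l, z.1 < N) → (level n N ++ l).Pairwise fun x y => y.1 ≤ x.1 := by
    intro N l h1 h2
    refine List.pairwise_append.2 ⟨hl N, h1, fun x hx y hy => ?_⟩
    rw [(mem_level.1 hx).1]
    exact (h2 y hy).le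
  refine hd (hd (hd (hl 1) ?_) ?_) ?_ <;>
    · intro z hz
      simp only [List.mem_append, mem_level] at hz
      omega

theorem prod_level (n N r : ℕ) (hr : (r + N) % 2 = 0) (hr' : r < 2) :
    ((level n N).map fun z => letterBraid z.2).prod =
      (((List.range (2 * n)).filter fun i => i % 2 = r).map (signedSigma n)).prod := by
  have h1 : (level n N).map (fun z => letterBraid z.2) =
      (level n N).map fun z => signedSigma n z.2.1 := by
    refine List.map_congr_left fun z hz => ?_
    rw [letterBraid_eq, (mem_level.1 hz).2.2, signedSigma]
    simp only [decide_eq_true_eq]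
  rw [h1, ← List.map_coe_finRange_eq_range, List.filter_map, List.map_map, level, List.map_map]
  congr 2
  refine List.filter_congr fun g _ => ?_
  simp only [Function.comp_apply, decide_eq_decide]
  omega

theorem closure_eq_of_perm_entries {n : ℕ} (hn : 1 ≤ n) {l : List (ℕ × Fin (2 * n) × Bool)}
    (hl : l.Perm (entries n)) (hs : l.Pairwise fun x y => y.1 ≤ x.1) :
    BraidWord.closure (l.map Prod.snd) = (minimalWord n).closure := by
  rw [← closureOf_toBraid, toBraid_eq_prod, List.map_map, ← closureOf_lemniscate_braid hn]
  congr 1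
  have hmem : ∀ z ∈ l, IsEntry n z := fun z hz => mem_entries.1 (hl.mem_iff.1 hz)
  refine (prod_map_eq_of_sorted (letterBraid ∘ Prod.snd) Prod.fst 4 hl hs (sorted_entries n)
    (fun z hz => (hmem z hz).1.2)
    (fun x hx y hy hxy => (hmem x hx).commute (hmem y hy) hxy)).trans ?_
  have h4 := prod_level n 4 0 (by norm_num) (by norm_num)
  have h3 := prod_level n 3 1 (by norm_num) (by norm_num)
  have h2 := prod_level n 2 0 (by norm_num) (by norm_num)
  have h1 := prod_level n 1 1 (by norm_num) (by norm_num)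
  rw [← h4]
  nth_rw 2 [h4]
  rw [← h3]
  nth_rw 2 [h3]
  rw [← h2, ← h1]
  simp only [entries, List.map_append, List.prod_append, mul_assoc]
  rfl

/-- The pairs (height index, letter) of any reading form a duplicate-free list with exactly the
elements of `entries n`, hence a permutation of it sorted by height. -/
theorem closure_of_readsAs {n : ℕ} (hn : 1 ≤ n) {a b : ℝ} (ha : 0 < a) (hb : 0 < b)
    {w : BraidWord (2 * n)}
    (h : ReadsAs (strandX (2 * n + 1) 2 a) (strandY (2 * n + 1) 2 2 b) w) :
    w.closure = (minimalWord n).closure := by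
  obtain ⟨ht, o, u, hanti, hrange, hcross, hinj, hall⟩ := h
  have hN : ∀ m, ∃ N : ℕ, (1 ≤ N ∧ N ≤ 4) ∧ ht m = N * Real.pi / 2 := fun m => by
    refine exists_height_of_meet ha (p := o m) (q := u m) ?_ (hrange m) (hcross m).meet
    intro hou
    have := (hcross m).higher
    rw [hou] at this
    exact lt_irrefl _ this
  choose N hN hht using hN
  have hslots : ∀ m, _ := fun m => by
    have := hcross m
    rw [hht m] at this
    exact this.slots hn (hN m) ha hb
  have hpi := Real.pi_pos
  set l : List (ℕ × Fin (2 * n) × Bool) := List.ofFn fun m => (N m, w.get m) with hl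
  have hw : l.map Prod.snd = w := by
    rw [hl, List.map_ofFn]
    exact List.ofFn_get w
  have hs : l.Pairwise fun x y => y.1 ≤ x.1 := by
    rw [hl, List.pairwise_ofFn]
    intro i j hij
    have := hanti hij.le
    rw [hht, hht] at this
    have h2 : (N j : ℝ) ≤ N i := by
      by_contra hcon
      nlinarith
    exact_mod_cast h2
  -- Height and letter determine the slot of the upper strand and so that strand; the injectivity
  -- clause of `ReadsAs` then excludes repetitions.
  have hnd : l.Nodup := by
    rw [hl, List.nodup_ofFn]
    intro i j hij
    rw [Prod.ext_iff] at hij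
    dsimp only at hij
    refine hinj (Prod.ext ?_ (Fin.ext ?_))
    · dsimp only; rw [hht, hht, hij.1]
    · refine slot_inj (n := n) (N := N i) (o i).isLt (o j).isLt ?_
      rw [(hslots i).2.2.1]
      conv_rhs => rw [hij.1, (hslots j).2.2.1]
      rw [hij.2]
  rw [← hw]
  refine closure_eq_of_perm_entries hn ?_ hs
  rw [List.perm_ext_iff_of_nodup hnd (nodup_entries n)]
  intro z
  rw [mem_entries, hl, List.mem_ofFn]
  constructor
  · rintro ⟨m, rfl⟩
    exact ⟨hN m, (hslots m).1, (hslots m).2.1⟩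
  · rintro ⟨h1, h2, h3⟩
    have hg := z.2.1.isLt
    have hov : -(2 * n : ℤ) ≤ overSlot n z.2.1 ∧ overSlot n z.2.1 ≤ 2 * n ∧
        (overSlot n z.2.1 - z.1) % 2 = 0 ∧ overSlot n z.2.1 ≠ 0 := by
      unfold overSlot; split_ifs <;> omega
    obtain ⟨p, hp⟩ := exists_slot_eq hn h1 hov.1 hov.2.1 hov.2.2.1
    obtain ⟨q, hq⟩ := exists_slot_eq hn h1 (v := -overSlot n z.2.1) (by omega) (by omega) (by omega)
    have hpq : p ≠ q := by rintro rfl; omega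
    have hle : (z.1 : ℝ) ≤ 4 := by exact_mod_cast h1.2
    have hge : (1 : ℝ) ≤ z.1 := by exact_mod_cast h1.1
    obtain ⟨m, hm, hm2⟩ := hall (z.1 * Real.pi / 2) ⟨by positivity, by nlinarith⟩ p q hpq
      ((strandX_eq_iff hn h1 ha p q).2 (by omega))
    have hNm : N m = z.1 := by
      rw [hht] at hm
      have : (N m : ℝ) = z.1 := by
        apply mul_right_cancel₀ hpi.ne'
        linarith
      exact_mod_cast this
    have hsl := hslots m
    rw [hNm] at hsl
    -- Whichever of the two strands is listed as upper, the absolute value of its slot is the same,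
    -- and it determines the position.
    have hpos : ((w.get m).1 : ℕ) = z.2.1 := by
      have h5 : (overSlot n (w.get m).1).natAbs = (overSlot n z.2.1).natAbs := by
        rcases hm2 with ⟨h5, -⟩ | ⟨h5, -⟩ <;> rw [h5] at hsl <;> omega
      have h6 := (w.get m).1.isLt
      unfold overSlot at h5
      split_ifs at h5 <;> omega
    refine ⟨m, Prod.ext hNm (Prod.ext (Fin.ext hpos) ?_)⟩
    dsimp only
    rw [hsl.2.1, h3, hpos]

theorem exists_readsAs {n : ℕ} (hn : 1 ≤ n) {a b : ℝ} (ha : 0 < a) (hb : 0 < b) :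
    ∃ w : BraidWord (2 * n),
      ReadsAs (strandX (2 * n + 1) 2 a) (strandY (2 * n + 1) 2 2 b) w := by
  have hpi := Real.pi_pos
  have hpq : ∀ z : ℕ × Fin (2 * n) × Bool, ∃ pq : Fin (2 * n + 1) × Fin (2 * n + 1),
      IsEntry n z → slot n z.1 pq.1 = overSlot n z.2.1 ∧ slot n z.1 pq.2 = -overSlot n z.2.1 := by
    intro z
    by_cases hz : IsEntry n z
    · obtain ⟨h1, h2, h3⟩ := hz
      have hg := z.2.1.isLt
      have hov : -(2 * n : ℤ) ≤ overSlot n z.2.1 ∧ overSlot n z.2.1 ≤ 2 * n ∧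
          (overSlot n z.2.1 - z.1) % 2 = 0 ∧ overSlot n z.2.1 ≠ 0 := by
        unfold overSlot; split_ifs <;> omega
      obtain ⟨p, hp⟩ := exists_slot_eq hn h1 hov.1 hov.2.1 hov.2.2.1
      obtain ⟨q, hq⟩ := exists_slot_eq hn h1 (v := -overSlot n z.2.1) (by omega) (by omega)
        (by omega)
      exact ⟨(p, q), fun _ => ⟨hp, hq⟩⟩
    -- Arbitrary value, never used: only genuine entries occur in the word.
    · exact ⟨(0, 0), fun h => absurd h hz⟩
  choose pq hpq using hpq
  set l := entries n with hl
  have hlen : (l.map Prod.snd).length = l.length := List.length_map _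
  set e : Fin (l.map Prod.snd).length → ℕ × Fin (2 * n) × Bool :=
    fun m => l.get (m.cast hlen) with he
  have hent : ∀ m, IsEntry n (e m) := fun m => mem_entries.1 (List.get_mem _ _)
  have hinj : Function.Injective e := fun i j hij => by
    have := (List.nodup_iff_injective_get.1 (nodup_entries n)) hij
    exact Fin.ext (by simpa using congrArg Fin.val this)
  have hget : ∀ m, (l.map Prod.snd).get m = (e m).2 := fun m => by simp [he]
  have hget2 : ∀ m, (l.map Prod.snd).get m = ((e m).2.1, decide (n ≤ ((e m).2.1 : ℕ))) := fun m => by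
    rw [hget, ← (hent m).2.2]
  refine ⟨l.map Prod.snd, fun m => (e m).1 * Real.pi / 2, fun m => (pq (e m)).1,
    fun m => (pq (e m)).2, ?_, ?_, ?_, ?_, ?_⟩
  · intro i j hij
    have h1 : (e j).1 ≤ (e i).1 := by
      rcases hij.lt_or_eq with hlt | rfl
      · exact List.pairwise_iff_get.1 (sorted_entries n) _ _ hlt
      · exact le_rfl
    have h2 : ((e j).1 : ℝ) ≤ (e i).1 := by exact_mod_cast h1
    dsimp only
    gcongr
  · intro m
    have hle : ((e m).1 : ℝ) ≤ 4 := by exact_mod_cast (hent m).1.2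
    have hge : (1 : ℝ) ≤ (e m).1 := by exact_mod_cast (hent m).1.1
    exact ⟨by positivity, by nlinarith⟩
  · intro m
    rw [hget2]
    exact isCrossing_of_slots hn (hent m).1 ha hb (hpq _ (hent m)).1 (hpq _ (hent m)).2
  · intro i j hij
    rw [Prod.ext_iff] at hij
    dsimp only at hij
    have h1 : (e i).1 = (e j).1 := by
      have : ((e i).1 : ℝ) = (e j).1 := by
        apply mul_right_cancel₀ hpi.ne'
        linarith [hij.1]
      exact_mod_cast this
    have h2 : overSlot n (e i).2.1 = overSlot n (e j).2.1 := by
      rw [← (hpq _ (hent i)).1, ← (hpq _ (hent j)).1, hij.2, h1]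
    have h3 : (e i).2.1 = (e j).2.1 := by
      have := (e i).2.1.isLt
      have := (e j).2.1.isLt
      unfold overSlot at h2
      ext1
      split_ifs at h2 <;> omega
    refine hinj (Prod.ext h1 (Prod.ext h3 ?_))
    rw [(hent i).2.2, (hent j).2.2, h3]
  · intro y hy p q hne hmeet
    obtain ⟨N, hN, rfl⟩ := exists_height_of_meet ha hne hy hmeet
    obtain ⟨h1, h2, h3⟩ := slot_eq_neg_of_meet hn hN ha hne hmeet
    have hmod := slot_mod_two n N p
    obtain ⟨g, hg, hg2⟩ : ∃ g : Fin (2 * n), ((g : ℕ) + N) % 2 = 0 ∧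
        (slot n N p = overSlot n g ∨ slot n N p = -overSlot n g) := by
      refine ⟨⟨2 * n - (slot n N p).natAbs, by omega⟩, by dsimp only; omega, ?_⟩
      unfold overSlot; dsimp only; split_ifs <;> omega
    have hent' : IsEntry n (N, g, decide (n ≤ (g : ℕ))) := ⟨hN, hg, rfl⟩
    obtain ⟨i, hi⟩ := List.get_of_mem (mem_entries.2 hent')
    obtain ⟨hp, hq⟩ := hpq _ hent'
    have hei : e (i.cast hlen.symm) = (N, g, decide (n ≤ (g : ℕ))) := hi
    refine ⟨i.cast hlen.symm, by dsimp only; rw [hei], ?_⟩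
    dsimp only
    rw [hei]
    dsimp only at hp hq
    rcases hg2 with hg2 | hg2
    · exact Or.inl ⟨Fin.ext (slot_inj (N := N) (Fin.isLt _) p.isLt (by omega)),
        Fin.ext (slot_inj (N := N) (Fin.isLt _) q.isLt (by omega))⟩
    · exact Or.inr ⟨Fin.ext (slot_inj (N := N) (Fin.isLt _) q.isLt (by omega)),
        Fin.ext (slot_inj (N := N) (Fin.isLt _) p.isLt (by omega))⟩

/-! ### Minimality of the three-strand word and the main theorem -/

theorem isMinimalBraidWord_minimalWord {n : ℕ} (hn : 1 ≤ n) :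
    IsMinimalBraidWord (minimalWord n) (minimalWord n).closure := by
  have hassoc : ∀ (k' : ℕ) (w' : BraidWord k'), w'.closure = (minimalWord n).closure →
      Associated (reducedDet w') (alexanderFormula n) := fun k' w' h =>
    (associated_reducedDet_of_closure_eq h).trans (associated_reducedDet_minimalWord n)
  have hk : ∀ (k' : ℕ) (w' : BraidWord k'), w'.closure = (minimalWord n).closure → 2 ≤ k' := by
    intro k' w' h
    have h1 := le_length_of_associated w' n (hassoc k' w' h)
    match k', w' with
    -- On one strand the only word is empty, too short for the bound 2n; two strands are excluded by
    -- the unit determinant.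
    | 0, [] => simp at h1; omega
    | 0, x :: _ => exact x.1.elim0
    | 1, w' => exact absurd (hassoc 1 w' h) (not_associated_two_strands w' hn)
    | k' + 2, _ => omega
  refine ⟨rfl, fun k' w' h => ?_, fun k' w' h => ?_⟩
  · have h1 := le_length_of_associated w' n (hassoc k' w' h)
    have h2 := hk k' w' h
    simp only [minimalWord, List.length_append, List.length_cons, List.length_nil,
      List.length_replicate]
    omega
  · have := hk k' w' h
    omega

end LemniscateKnot

theorem theorem2 (n : ℕ) (hn : 1 ≤ n) :
    ∃ L : LemniscateKnot.LinkType,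
      (∀ a b : ℝ, 0 < a → 0 < b → ∀ L' : LemniscateKnot.LinkType,
        LemniscateKnot.IsLemniscateKnot (2 * n) 2 2 a b L' ↔ L' = L) ∧
      LemniscateKnot.IsMinimalBraidWord (LemniscateKnot.minimalWord n) L ∧
      LemniscateKnot.IsAlexanderPolynomial L (LemniscateKnot.alexanderFormula n) ∧
      ∀ i j : Fin 3,
        Associated
          ((LemniscateKnot.burau (LemniscateKnot.minimalWord n) - 1).submatrix
            i.succAbove j.succAbove).det
          (LemniscateKnot.alexanderFormula n) := by
  refine ⟨(LemniscateKnot.minimalWord n).closure, fun a b ha hb L' => ⟨?_, ?_⟩,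
    LemniscateKnot.isMinimalBraidWord_minimalWord hn,
    LemniscateKnot.isAlexanderPolynomial_of_associated _ _
      (LemniscateKnot.associated_reducedDet_minimalWord n),
    fun i j => (LemniscateKnot.associated_minor _ i j).trans
      (LemniscateKnot.associated_reducedDet_minimalWord n)⟩
  · rintro ⟨w, hw, rfl⟩
    exact LemniscateKnot.closure_of_readsAs hn ha hb hw
  · rintro rfl
    obtain ⟨w, hw⟩ := LemniscateKnot.exists_readsAs hn ha hb
    exact ⟨w, hw, LemniscateKnot.closure_of_readsAs hn ha hb hw⟩
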